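/- **Indexing.** A *weak lattice* is a small connected category $\mathcal J$ with finite Hom-sets and a degree function $|\cdot|:\mathrm{Ob}\,\mathcal J\to\mathbb N$, with finitely many objects in each degree, such that every non-identity map strictly lowers degree and every object maps to an object of degree $0$. For $x\in\mathcal J$, $\mathcal J_x^k$ is the full subcategory on $x$ and all $t$ with $|t|\le k$ and $\mathcal J(x,t)\ne\emptyset$; $\partial\mathcal J_x^k$ is $\mathcal J_x^k$ with $x$ removed. All products below run over objects of $\partial\mathcal J_x^k$ and all maps to them, and are written $\prod_{y\to s,\,|s|=m}$ etc. **Data.** Let $\mathcal E$ be a model category, $L:\mathcal E\to\mathrm{ho}\,\mathcal E$ its localization at the weak equivalences, $x\in\mathcal J$ and $|x|>n\ge k\ge2$. Let $\widetilde Y_x^k:\mathcal J_x^k\to\mathrm{ho}\,\mathcal E$, $Y_x^{k-1}:\mathcal J_x^{k-1}\to\mathcal E$ and $Y=Y^k:\partial\mathcal J_x^k\to\mathcal E$ be functors such that $Y_x^{k-1}$ and $Y^k$ agree on $\partial\mathcal J_x^{k-1}$ and both lift the corresponding restriction of $\widetilde Y_x^k$. Assume that $Y(x)=Y_x^{k-1}(x)$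 is cofibrant and that $Y^k$ is Reedy fibrant: each matching map $Y(s)\to M^s_{|s|-1}$ is a fibration, where $M^y_{m-1}$ is the limit of the $Y(t)$ over all $y\to t$ with $|t|<m$. Let $\sim$ denote left homotopy of maps. **Total operation.** For any $y$ and $m\ge 1$ let $\Psi:\prod_{y\to t,|t|<m}Y(t)\to\prod_{y\to s,|s|=m}\prod_{s\to v,|v|<m}Y(v)$ be the generalized diagonal, whose component at $y\to s\to v$ is the projection belonging to the composite $y\to v$. Let $Q^y_{m-1}$ be the pullback, along $\Psi$, of the product of forgetful maps $\prod_{y\to s,|s|=m}M^s_{m-1}\to\prod_{y\to s,|s|=m}\prod_{s\to v,|v|<m}Y(v)$. Let $P^y_m$ be the pullback of $Q^y_{m-1}\to\prod_{y\to s,|s|=m}M^s_{m-1}$ and the product of the matching maps $\prod_{y\to s,|s|=m}Y(s)\to\prod_{y\to s,|s|=m} M^s_{m-1}$. Let $N^y_{m-1}$ be the pullback of the forgetful map $M^y_{m-1}\to\prod_{y\to t,|t|<m}Y(t)$ and $Q^y_{m-1}\to\prod_{y\to t,|t|<m}Y(t)$. There are canonical maps $M^y_m\to P^y_m$ and $M^y_m\to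 N^y_{m-1}$. Now take $y=x$, $m=k$. The values of $Y_x^{k-1}$ on maps give $\sigma_{<k}:Y(x)\to\prod_{x\to t,|t|<k}Y(t)$ and $\eta:Y(x)\to Q^x_{k-1}$. Let $\sigma:Y(x)\to\prod_{x\to s,|s|=k}Y(s)$ represent $\widetilde Y_x^k$, i.e. its component at each $g:x\to s$ is a representative of $\widetilde Y_x^k(g)$. Factor $\Psi$ as a trivial cofibration $\iota$ into an object $F^1$ followed by a fibration $\Psi'$, and let $F^2$ be the pullback of $F^1$ and $\prod_{x\to s,|s|=k} M^s_{k-1}$ over the target of $\Psi$. The *total operation* $\langle Y_x^{k-1}\rangle$ is the set of homotopy classes of maps $\theta:Y(x)\to F^2$ whose image $\phi:Y(x)\to F^1$ satisfies $\phi\sim\iota\sigma_{<k}$ and $\Psi'\phi=(\prod_s\sigma^s_{<k})\,\sigma$, where $\sigma^s_{<k}:Y(s)\to\prod_{s\to v,|v|<k}Y(v)$ is given by the values of $Y$ on maps. It *vanishes* if it contains the class of $\gamma\eta$, where $\gamma:Q^x_{k-1}\to F^2$ is induced by the projection $Q^x_{k-1}\to\prod_{x\to s,|s|=k} M^s_{k-1}$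 and $Q^x_{k-1}\to\prod_{x\to t,|t|<k} Y(t)\xrightarrow{\iota}F^1$. **Separation grid.** For each $y$ and $m\ge2$ one has a *grid* of objects $F^{j,i}=F_{y,m}^{j,i}$, all of whose rectangles are pullbacks, obtained by induction on $m$. * Column $0$ is $$F^{0,m+1}=\prod_{y\to s,|s|=m}Y(s)\to F^{0,m}=\prod_{y\to s,|s|=m}M^s_{m-1}\to F^{0,m-1}\to\dots\to F^{0,2}\to F^{0,1}=\prod_{y\to s,|s|=m}\ \prod_{s\to v,|v|<m}Y(v).$$ For $m=2$ there are no objects between $F^{0,2}=\prod M^s_1$ and $F^{0,1}$. For $m\ge3$, $F^{0,i}=\prod_{y\to s,|s|=m}\bigl(F_{s,m-1}^{i-1,m}\times G_{s,m-1}^{i-1,m}\bigr)$ for $2\le i\le m-1$, for the towers defined below. * Column $1$ is the pullback of column $0$ along the fibration $q_1:F^{1,1}\to F^{0,1}$, where $\prod_{y\to t,|t|<m}Y(t)\to F^{1,1}\to F^{0,1}$ is a factorization of $\Psi$ as a trivial cofibration followed by a fibration; $\varphi^1$ is the composite $Q^y_{m-1}\to\prod_{y\to t,|t|<m}Y(t)\to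 F^{1,1}$. For $2\le j\le m-1$ one factors the induced map $Q^y_{m-1}\to F^{j-1,j}$ as a trivial cofibration $\varphi^j:Q^y_{m-1}\to F^{j,j}$ followed by a fibration $q_j:F^{j,j}\to F^{j-1,j}$, and column $j$, consisting of $F^{j,m+1}\to F^{j,m}\to\dots\to F^{j,j}$, is the pullback along $q_j$ of the part of column $j-1$ above $F^{j-1,j}$. Write $q_m\varphi^m$ for the induced map $Q^y_{m-1}\to F^{m-1,m}$. * The tower $M^y_m\to F_{y,m}^{m-1,m+1}\to\dots\to F_{y,m}^{1,m+1}\to\prod_{y\to v,|v|=m}Y(v)$ is, for $m\ge3$, the top row of the grid for $(y,m)$ preceded by $M^y_m\to P^y_m\to F^{m-1,m+1}_{y,m}$. For $m=2$ it is a chosen factorization $M^y_2\to F_{y,2}^{1,3}\to\prod_{y\to v,|v|=2}Y(v)$ as a weak equivalence followed by a fibration. * In the tower $M^y_m\to G_{y,m}^{m-1,m+1}\to\dots\to G_{y,m}^{1,m+1}\to\prod_{y\to t,|t|<m}Y(t)$, the object $G_{y,m}^{j,m+1}$ for $1\le j\le m-2$ is the pullback of $F^{0,j+1}_{y,m}$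 along $\Psi$. The last object $G_{y,m}^{m-1,m+1}$ comes from a factorization, as a trivial cofibration followed by a fibration, of the map from $N^y_{m-1}$ to $G_{y,m}^{m-2,m+1}$ (to $\prod_{y\to t,|t|<m}Y(t)$ if $m=2$) through $Q^y_{m-1}$; this factorization is preceded by $M^y_m\to N^y_{m-1}$. Take the grid for $y=x$, $m=k$; then $F^{1,1}=F^1$ and $F^{1,k}=F^2$. Let $u_j:F^{j,k+1}\to F^{j-1,k+1}$ and $p_j:F^{j,j+1}\to F^{j-1,j+1}$ be the horizontal maps, $r_j:F^{j,j+1}\to F^{j,j}$ the vertical map, and $\Phi^j:F^{j,k+1}\to F^{j,j+1}$ the vertical composite. Put $\kappa_0=\sigma$. **Separated operations.** Let $1\le j<k$ and let $\kappa_{j-1}:Y(x)\to F^{j-1,k+1}$ be given. The *separated operation* $\langle Y_x^{k-1}\rangle^{j+1}$ determined by $\kappa_{j-1}$ is the set of homotopy classes of maps $\theta:Y(x)\to F^{j,j+1}$ with $r_j\theta\sim\varphi^j\eta$ and * if $j<k-1$: $p_j\theta$ equals the composite of $\kappa_{j-1}$ with the vertical map $F^{j-1,k+1}\to F^{j-1,j+1}$;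 * if $j=k-1$: $q_{k-1}r_{k-1}\theta$ equals the composite of $\kappa_{k-2}$ with the vertical map $F^{k-2,k+1}\to F^{k-2,k-1}$. It *vanishes* if it contains the class of $q_{j+1}\varphi^{j+1}\eta$. For $j<k-1$, a *continuation* of $\kappa_{j-1}$ is a map $\kappa_j:Y(x)\to F^{j,k+1}$ with $u_j\kappa_j=\kappa_{j-1}$ and $\Phi^j\kappa_j\sim q_{j+1}\varphi^{j+1}\eta$. The separated operations *vanish in turn* if there are $\kappa_1,\dots,\kappa_{k-2}$, each $\kappa_j$ a continuation of $\kappa_{j-1}$, such that for every $1\le j<k$ the operation $\langle Y_x^{k-1}\rangle^{j+1}$ determined by $\kappa_{j-1}$ vanishes. **Theorem.** The factorizations required above exist, and so does a map $\sigma$ representing $\widetilde Y_x^k$. For every choice of the factorizations and of $\sigma$, the total operation $\langle Y_x^{k-1}\rangle$ is non-empty, and it separates into a sequence of $k-1$ operations $\langle Y_x^{k-1}\rangle^{j+1}$, $1\le j<k$, each defined once the previous one vanishes: the operation determined by $\kappa_0=\sigma$ is non-empty; for $j<k-1$ and any $\kappa_{j-1}$ reached from $\kappa_0$ by successive continuations,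 $\kappa_{j-1}$ has a continuation if and only if the operation it determines vanishes; and the operation determined by any $\kappa_j$ so reached is again non-empty. Moreover the following are equivalent: 1. there is a functor $Y_x^k:\mathcal J_x^k\to\mathcal E$ which restricts to $Y_x^{k-1}$ on $\mathcal J_x^{k-1}$ and to $Y^k$ on $\partial\mathcal J_x^k$ and satisfies $L\circ Y_x^k=\widetilde Y_x^k$; 2. the total operation $\langle Y_x^{k-1}\rangle$ vanishes; 3. the separated operations $\langle Y_x^{k-1}\rangle^{j+1}$, $1\le j<k$, vanish in turn. -/

import Mathlib

open CategoryTheory CategoryTheory.Limits HomotopicalAlgebra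

universe w v u

/-- A weak lattice: a connected, locally finite indexing category with a degree function, finitely
many objects in each degree, in which every non-identity morphism strictly lowers the degree and
every object maps to one of degree zero.  (It is a Reedy category whose direct subcategory
consists of the identities only and whose inverse subcategory is everything.) -/
class WeakLattice (J : Type w) [SmallCategory J] where
  deg : J → ℕ
  connected : IsConnected J
  finite_hom : ∀ a b : J, Finite (a ⟶ b)
  finite_deg : ∀ d : ℕ, {a : J | deg a = d}.Finite
  deg_lt : ∀ {a b : J} (f : a ⟶ b), (∃ h : a = b, f = eqToHom h) ∨ deg b < deg a
  to_zero : ∀ a : J, ∃ b : J, deg b = 0 ∧ Nonempty (a ⟶ b)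

namespace HigherOp

noncomputable section

open WeakLattice

/-! ### Indexing categories -/

section Index

variable {J : Type w} [SmallCategory J] [WeakLattice J]

/-- `𝒥ₓᵏ`: the full subcategory on `x` and on the objects under `x` of degree at most `k`. -/
def jx (x : J) (k : ℕ) : ObjectProperty J := fun t => Nonempty (x ⟶ t) ∧ (t = x ∨ deg t ≤ k)

/-- `∂𝒥ₓᵏ`: the full subcategory of `𝒥ₓᵏ` on the objects other than `x`. -/
def djx (x : J) (k : ℕ) : ObjectProperty J := fun t => jx x k t ∧ t ≠ x

lemma djx_le_jx (x : J) (k : ℕ) : djx x k ≤ jx x k := fun _ h => h.1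

lemma jx_mono (x : J) {k l : ℕ} (h : k ≤ l) : jx x k ≤ jx x l :=
  fun _ ht => ⟨ht.1, ht.2.imp id (fun h' => h'.trans h)⟩

lemma djx_mono (x : J) {k l : ℕ} (h : k ≤ l) : djx x k ≤ djx x l :=
  fun t ht => ⟨jx_mono x h t ht.1, ht.2⟩

lemma jx_self (x : J) (k : ℕ) : jx x k x := ⟨⟨𝟙 x⟩, Or.inl rfl⟩

/-- The maps from `y` to objects of `P` of degree `< m`: the objects of the comma category. -/
@[ext]
structure LowArr (P : ObjectProperty J) (y : J) (m : ℕ) : Type w where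
  tgt : P.FullSubcategory
  deg_lt : deg tgt.obj < m
  hom : y ⟶ tgt.obj

/-- The maps in the comma category: commutative triangles under `y`. -/
@[ext]
structure LowArr.Hom {P : ObjectProperty J} {y : J} {m : ℕ} (f g : LowArr P y m) : Type w where
  map : f.tgt ⟶ g.tgt
  comm : f.hom ≫ map.hom = g.hom

instance (P : ObjectProperty J) (y : J) (m : ℕ) : SmallCategory (LowArr P y m) where
  Hom f g := LowArr.Hom f g
  id f := ⟨𝟙 _, by simp⟩
  comp a b := ⟨a.map ≫ b.map, by
    rw [ObjectProperty.FullSubcategory.comp_hom, ← Category.assoc, a.comm, b.comm]⟩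
  id_comp _ := LowArr.Hom.ext (Category.id_comp _)
  comp_id _ := LowArr.Hom.ext (Category.comp_id _)
  assoc _ _ _ := LowArr.Hom.ext (Category.assoc _ _ _)

/-- The maps from `y` to objects of `P` of degree `m`. -/
@[ext]
structure LevArr (P : ObjectProperty J) (y : J) (m : ℕ) : Type w where
  tgt : P.FullSubcategory
  deg_eq : deg tgt.obj = m
  hom : y ⟶ tgt.obj

lemma finite_deg_lt (m : ℕ) : Finite {a : J // deg a < m} := by
  have : {a : J | deg a < m} = ⋃ d ∈ Set.Iio m, {a : J | deg a = d} := by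
    ext a; simp
  exact (this ▸ (Set.finite_Iio m).biUnion (fun d _ => finite_deg d) :
    {a : J | deg a < m}.Finite)

instance (P : ObjectProperty J) (y : J) (m : ℕ) : Finite (LowArr P y m) := by
  have := finite_deg_lt (J := J) m
  have : ∀ t : {a : J // deg a < m}, Finite (y ⟶ t.1) := fun t => finite_hom y t.1
  let F : LowArr P y m → Σ t : {a : J // deg a < m}, (y ⟶ t.1) :=
    fun f => ⟨⟨f.tgt.obj, f.deg_lt⟩, f.hom⟩
  refine Finite.of_injective F ?_
  rintro ⟨⟨a, ha⟩, hfa, f⟩ ⟨⟨b, hb⟩, hgb, g⟩ h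
  simp only [F, Sigma.mk.injEq, Subtype.mk.injEq] at h
  obtain ⟨h1, h2⟩ := h
  subst h1
  simp only [heq_eq_eq] at h2
  subst h2
  rfl

/-- A map to an object of degree `m` as a map to an object of degree `< m + 1`. -/
abbrev LevArr.toLow {P : ObjectProperty J} {y : J} {m : ℕ} (g : LevArr P y m) :
    LowArr P y (m + 1) where
  tgt := g.tgt
  deg_lt := Nat.lt_succ_of_le g.deg_eq.le
  hom := g.hom

instance (P : ObjectProperty J) (y : J) (m : ℕ) : Finite (LevArr P y m) := by
  refine Finite.of_injective (LevArr.toLow (P := P) (y := y) (m := m)) ?_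
  rintro ⟨a, ha, f⟩ ⟨b, hb, g⟩ h
  simp only [LevArr.toLow, LowArr.mk.injEq] at h
  obtain ⟨h1, h2⟩ := h
  subst h1
  simp only [heq_eq_eq] at h2
  subst h2
  rfl

instance (P : ObjectProperty J) (y : J) (m : ℕ) : FinCategory (LowArr P y m) where
  fintypeObj := Fintype.ofFinite _
  fintypeHom f g := by
    have : Finite (f.tgt.obj ⟶ g.tgt.obj) := finite_hom _ _
    have : Finite (LowArr.Hom f g) := Finite.of_injective
      (fun a => (a.map.hom : f.tgt.obj ⟶ g.tgt.obj)) (fun a b h => by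
        apply LowArr.Hom.ext
        apply ObjectProperty.hom_ext
        exact h)
    exact Fintype.ofFinite (LowArr.Hom f g)

/-- The composite `y ⟶ s ⟶ v` of `g : y ⟶ s` and `f : s ⟶ v`. -/
abbrev LevArr.comp {P : ObjectProperty J} {y : J} {m : ℕ} (g : LevArr P y m)
    (f : LowArr P g.tgt.obj m) : LowArr P y m where
  tgt := f.tgt
  deg_lt := f.deg_lt
  hom := g.hom ≫ f.hom

/-- A map to an object of degree `< m` as a map to an object of degree `< m + 1`. -/
abbrev LowArr.succ {P : ObjectProperty J} {y : J} {m : ℕ} (f : LowArr P y m) :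
    LowArr P y (m + 1) where
  tgt := f.tgt
  deg_lt := f.deg_lt.trans (Nat.lt_succ_self m)
  hom := f.hom

end Index

/-! ### Towers of factorizations -/

section Tower

variable {E : Type u} [Category.{v} E]

/-- A tower of height `n` on `f : A ⟶ B`: a factorization of `f` as
`A ⟶ Xₙ ⟶ ⋯ ⟶ X₁ ⟶ B` through `n` intermediate objects. -/
inductive Tower : ℕ → ∀ {A B : E}, (A ⟶ B) → Type (max u v)
  | base {A B : E} (f : A ⟶ B) : Tower 0 f
  | step {A B X : E} {n : ℕ} {f : A ⟶ B} (i : A ⟶ X) (p : X ⟶ B) (fac : i ≫ p = f)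
      (t : Tower n i) : Tower (n + 1) f

namespace Tower

variable {A B : E} {n : ℕ} {f : A ⟶ B}

/-- The lowest intermediate object `X₁`. -/
def mid : Tower (n + 1) f → E
  | step (X := X) _ _ _ _ => X

/-- The map from `A` to the lowest intermediate object. -/
def i : (t : Tower (n + 1) f) → (A ⟶ t.mid)
  | step i _ _ _ => i

/-- The map from the lowest intermediate object to `B`. -/
def p : (t : Tower (n + 1) f) → (t.mid ⟶ B)
  | step _ p _ _ => p

@[simp]
lemma fac : (t : Tower (n + 1) f) → t.i ≫ t.p = f
  | step _ _ w _ => w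

@[simp]
lemma fac_assoc (t : Tower (n + 1) f) {C : E} (h : B ⟶ C) : t.i ≫ t.p ≫ h = f ≫ h := by
  rw [← Category.assoc, fac]

/-- The part of the tower above its lowest intermediate object. -/
def upper : (t : Tower (n + 1) f) → Tower n t.i
  | step _ _ _ t => t

/-- Transport along an equality of maps. -/
def congr {g : A ⟶ B} (h : f = g) (t : Tower n f) : Tower n g := h ▸ t

/-- Change the top of a tower along `a : Z ⟶ A`. -/
def precomp : ∀ {n : ℕ} {A B : E} {f : A ⟶ B} (_ : Tower n f) {Z : E} (a : Z ⟶ A), Tower n (a ≫ f)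
  | 0, _, _, f, _, _, a => base (a ≫ f)
  | _ + 1, _, _, _, t, _, a => step (a ≫ t.i) t.p (by simp) (t.upper.precomp a)

/-- Change the bottom of a tower along `b : B ⟶ C`. -/
def postcomp : ∀ {n : ℕ} {A B : E} {f : A ⟶ B} (_ : Tower n f) {C : E} (b : B ⟶ C), Tower n (f ≫ b)
  | 0, _, _, f, _, _, b => base (f ≫ b)
  | _ + 1, _, _, _, t, _, b => step t.i (t.p ≫ b) (by simp) t.upper

/-- The product of two towers with the same top: its intermediate objects are the products of the
intermediate objects. -/
def prodUnder [HasBinaryProducts E] : ∀ {n : ℕ} {Z B C : E} {f : Z ⟶ B} {g : Z ⟶ C}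
    (_ : Tower n f) (_ : Tower n g), Tower n (prod.lift f g)
  | 0, _, _, _, f, g, _, _ => base (prod.lift f g)
  | _ + 1, _, _, _, _, _, s, t =>
    step (prod.lift s.i t.i) (prod.map s.p t.p) (by simp) (s.upper.prodUnder t.upper)

/-- The product of a finite family of towers. -/
def pi [HasFiniteProducts E] {I : Type w} [Finite I] : ∀ {n : ℕ} {A B : I → E}
    {f : ∀ i, A i ⟶ B i} (_ : ∀ i, Tower n (f i)), Tower n (Limits.Pi.map f)
  | 0, _, _, f, _ => base (Limits.Pi.map f)
  | _ + 1, _, _, _, t =>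
    step (Limits.Pi.map fun i => (t i).i) (Limits.Pi.map fun i => (t i).p)
      (by ext; simp) (pi fun i => (t i).upper)

/-- The pullback of a tower on `f : A ⟶ B` along `g : B' ⟶ B`: its intermediate objects are the
pullbacks of those of the given tower.  The new top `Z` is any object with compatible maps to `A`
and `B'`. -/
def pb [HasPullbacks E] : ∀ {n : ℕ} {A B : E} {f : A ⟶ B} (_ : Tower n f) {Z B' : E}
    (g : B' ⟶ B) (a : Z ⟶ A) (b : Z ⟶ B') (_ : a ≫ f = b ≫ g), Tower n b
  | 0, _, _, _, _, _, _, _, _, b, _ => base b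
  | _ + 1, _, _, _, t, _, _, g, a, b, w =>
    step (pullback.lift (f := t.p) (g := g) (a ≫ t.i) b (by simpa using w))
      (pullback.snd t.p g) (pullback.lift_snd _ _ _)
      (t.upper.pb (pullback.fst t.p g) a
        (pullback.lift (f := t.p) (g := g) (a ≫ t.i) b (by simpa using w))
        (pullback.lift_fst _ _ _).symm)

end Tower

end Tower

/-! ### Grids and separated operations -/

section Grid

variable {E : Type u} [Category.{v} E] [ModelCategory E]

variable (E) in
/-- A choice, for every map, of a factorization as a trivial cofibration followed by a
fibration. -/
abbrev Factorizer := MorphismProperty.FactorizationData (trivialCofibrations E) (fibrations E)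

/-- Factor the topmost map of a tower (the one out of `A`) as a trivial cofibration followed by a
fibration. -/
def Tower.refineTop (fz : Factorizer E) : ∀ {n : ℕ} {A B : E} {f : A ⟶ B} (_ : Tower n f),
    Tower (n + 1) f
  | 0, _, _, f, _ => .step (fz f).i (fz f).p (fz f).fac (.base _)
  | _ + 1, _, _, _, t => .step t.i t.p t.fac (t.upper.refineTop fz)

/-- A column of a pullback grid under `Q`: maps `W ⟶ A ⟶ B` with a tower
`A ⟶ Xₙ ⟶ ⋯ ⟶ X₁ ⟶ B` on the second one, together with a map `Q ⟶ A`. -/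
structure Col (Q : E) (n : ℕ) where
  W : E
  A : E
  B : E
  top : W ⟶ A
  f : A ⟶ B
  tow : Tower n f
  q : Q ⟶ A

namespace Col

variable {Q : E} {n : ℕ}

/-- The next column of the grid: the pullback of the column `c` along `p : B' ⟶ c.B`, for a map
`b : Q ⟶ B'` compatible with `Q ⟶ c.A`. -/
abbrev pull (c : Col Q n) {B' : E} (p : B' ⟶ c.B) (b : Q ⟶ B') (w : c.q ≫ c.f = b ≫ p) :
    Col Q n where
  W := pullback c.top (pullback.fst c.f p)
  A := pullback c.f p
  B := B'
  top := pullback.snd _ _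
  f := pullback.snd _ _
  tow := c.tow.pb p (pullback.fst c.f p) (pullback.snd c.f p) pullback.condition
  q := pullback.lift c.q b w

/-- The column `c` with its lowest entry removed. -/
abbrev upper (c : Col Q (n + 1)) : Col Q n where
  W := c.W
  A := c.A
  B := c.tow.mid
  top := c.top
  f := c.tow.i
  tow := c.tow.upper
  q := c.q

/-- The horizontal map from the top entry of the pulled back column to the top entry of `c`. -/
def pullW (c : Col Q n) {B' : E} (p : B' ⟶ c.B) (b : Q ⟶ B') (w : c.q ≫ c.f = b ≫ p) :
    (c.pull p b w).W ⟶ c.W :=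
  pullback.fst _ _

/-- The induced map to the top entry of the pulled back column. -/
def liftW (c : Col Q n) {B' : E} (p : B' ⟶ c.B) (b : Q ⟶ B') (w : c.q ≫ c.f = b ≫ p)
    {Z : E} (zW : Z ⟶ c.W) (zQ : Z ⟶ Q) (h : zW ≫ c.top = zQ ≫ c.q) :
    Z ⟶ (c.pull p b w).W :=
  pullback.lift zW (zQ ≫ (c.pull p b w).q)
    (by rw [Category.assoc, pullback.lift_fst, h])

lemma liftW_pullW (c : Col Q n) {B' : E} (p : B' ⟶ c.B) (b : Q ⟶ B') (w : c.q ≫ c.f = b ≫ p)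
    {Z : E} (zW : Z ⟶ c.W) (zQ : Z ⟶ Q) (h : zW ≫ c.top = zQ ≫ c.q) :
    c.liftW p b w zW zQ h ≫ c.pullW p b w = zW :=
  pullback.lift_fst _ _ _

lemma liftW_top (c : Col Q n) {B' : E} (p : B' ⟶ c.B) (b : Q ⟶ B') (w : c.q ≫ c.f = b ≫ p)
    {Z : E} (zW : Z ⟶ c.W) (zQ : Z ⟶ Q) (h : zW ≫ c.top = zQ ≫ c.q) :
    c.liftW p b w zW zQ h ≫ (c.pull p b w).top = zQ ≫ (c.pull p b w).q :=
  pullback.lift_snd _ _ _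

/-- The column `c` without its lowest entry, pulled back along the fibration in the chosen
factorization `Q ⟶ B' ⟶ X₁` of the map from `Q` to the second lowest entry `X₁` of `c`. -/
abbrev next (c : Col Q (n + 1)) (fz : Factorizer E) : Col Q n :=
  c.upper.pull (fz (c.q ≫ c.tow.i)).p (fz (c.q ≫ c.tow.i)).i (fz (c.q ≫ c.tow.i)).fac.symm

/-- The top row of the grid generated by the column `c`: an iterated factorization of `Z ⟶ W`,
for an object `Z` with compatible maps to `W` and to `Q`, through the top entries of the
subsequent columns. -/
def topRow (fz : ℕ → Factorizer E) : ∀ {n : ℕ} (_ : ℕ) (c : Col Q n) {Z : E} (zW : Z ⟶ c.W)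
    (zQ : Z ⟶ Q) (_ : zW ≫ c.top = zQ ≫ c.q), Tower n zW
  | 0, _, _, _, zW, _, _ => .base zW
  | _ + 1, j, c, _, zW, zQ, h =>
    .step (c.upper.liftW _ _ (fz j _).fac.symm zW zQ h) (c.upper.pullW _ _ _)
      (c.upper.liftW_pullW _ _ _ zW zQ h)
      (topRow fz (j + 1) (c.next (fz j))
        (c.upper.liftW _ _ (fz j _).fac.symm zW zQ h) zQ
        (c.upper.liftW_top _ _ _ zW zQ h))

/-! In the definitions below `d` is the part of the column with number `j - 1` from row `j` upwards
(so `d.B = F^{j-1,j}` and `d.W = F^{j-1,k+1}`), and `b : Q ⟶ B'`, `p : B' ⟶ d.B` are the maps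
`φ^j : Q ⟶ F^{j,j}` and `q_j : F^{j,j} ⟶ F^{j-1,j}`; the column with number `j` is `d.pull p b w`.
Furthermore `η : Y ⟶ Q`, and `κ : Y ⟶ F^{j-1,k+1}` is the map `κ_{j-1}`. -/

variable {Y : E}

/-- The separated operation of order `j + 1` for `j < k - 1`: the homotopy classes of those
`θ : Y ⟶ F^{j,j+1}` such that `r_j θ ∼ φ^j η` and `p_j θ` equals the composite of `κ_{j-1}` with
the vertical map `F^{j-1,k+1} ⟶ F^{j-1,j+1}`. -/
def sepOp (d : Col Q (n + 1)) {B' : E} (p : B' ⟶ d.B) (b : Q ⟶ B') (w : d.q ≫ d.f = b ≫ p)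
    (η : Y ⟶ Q) (κ : Y ⟶ d.W) : Set (LeftHomotopyClass Y (d.pull p b w).tow.mid) :=
  {c | ∃ θ : Y ⟶ (d.pull p b w).tow.mid, c = LeftHomotopyClass.mk θ ∧
    LeftHomotopyRel (θ ≫ (d.pull p b w).tow.p) (η ≫ b) ∧
    θ ≫ (pullback.fst d.tow.p p : (d.pull p b w).tow.mid ⟶ d.tow.mid) = κ ≫ d.top ≫ d.tow.i}

/-- The separated operation of order `j + 1` for `j = k - 1`: the homotopy classes of those
`θ : Y ⟶ F^{k-1,k}` such that `r_{k-1} θ ∼ φ^{k-1} η` and `q_{k-1} r_{k-1} θ` equals the composite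
of `κ_{k-2}` with the vertical map `F^{k-2,k+1} ⟶ F^{k-2,k-1}`. -/
def sepOpLast (d : Col Q 0) {B' : E} (p : B' ⟶ d.B) (b : Q ⟶ B') (w : d.q ≫ d.f = b ≫ p)
    (η : Y ⟶ Q) (κ : Y ⟶ d.W) : Set (LeftHomotopyClass Y (d.pull p b w).A) :=
  {c | ∃ θ : Y ⟶ (d.pull p b w).A, c = LeftHomotopyClass.mk θ ∧
    LeftHomotopyRel (θ ≫ (d.pull p b w).f) (η ≫ b) ∧
    θ ≫ (d.pull p b w).f ≫ p = κ ≫ d.top ≫ d.f}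

/-- The separated operation vanishes if it contains the class of `q_{j+1} φ^{j+1} η`. -/
def SepVanishes (d : Col Q (n + 1)) {B' : E} (p : B' ⟶ d.B) (b : Q ⟶ B')
    (w : d.q ≫ d.f = b ≫ p) (η : Y ⟶ Q) (κ : Y ⟶ d.W) : Prop :=
  LeftHomotopyClass.mk (η ≫ (d.pull p b w).q ≫ (d.pull p b w).tow.i) ∈ d.sepOp p b w η κ

/-- The last separated operation vanishes if it contains the class of `q_k φ^k η`, where
`q_k φ^k` is the map `Q ⟶ F^{k-1,k}`. -/
def SepVanishesLast (d : Col Q 0) {B' : E} (p : B' ⟶ d.B) (b : Q ⟶ B')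
    (w : d.q ≫ d.f = b ≫ p) (η : Y ⟶ Q) (κ : Y ⟶ d.W) : Prop :=
  LeftHomotopyClass.mk (η ≫ (d.pull p b w).q) ∈ d.sepOpLast p b w η κ

/-- A map `κ' = κ_j : Y ⟶ F^{j,k+1}` is an admissible continuation of `κ = κ_{j-1}` if
`u_j κ_j = κ_{j-1}` and if the composite `Φ^j κ_j` of `κ_j` with the vertical map
`F^{j,k+1} ⟶ F^{j,j+1}` is homotopic to `q_{j+1} φ^{j+1} η`. -/
def Continues (d : Col Q (n + 1)) {B' : E} (p : B' ⟶ d.B) (b : Q ⟶ B')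
    (w : d.q ≫ d.f = b ≫ p) (η : Y ⟶ Q) (κ : Y ⟶ d.W) (κ' : Y ⟶ (d.pull p b w).W) : Prop :=
  κ' ≫ d.pullW p b w = κ ∧
    LeftHomotopyRel (κ' ≫ (d.pull p b w).top ≫ (d.pull p b w).tow.i)
      (η ≫ (d.pull p b w).q ≫ (d.pull p b w).tow.i)

/-- The `n + 1` separated operations of orders `j + 1, j + 2, …, j + n + 1 = k` vanish in turn:
the operation determined by `κ_{j-1}` vanishes, and there is an admissible continuation `κ_j` for
which the remaining operations vanish in turn. -/
def AllVanish (fz : ℕ → Factorizer E) (η : Y ⟶ Q) : ∀ {n : ℕ} (_ : ℕ) (d : Col Q n) {B' : E}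
    (p : B' ⟶ d.B) (b : Q ⟶ B') (_ : d.q ≫ d.f = b ≫ p) (_ : Y ⟶ d.W), Prop
  | 0, _, d, _, p, b, w, κ => d.SepVanishesLast p b w η κ
  | _ + 1, j, d, _, p, b, w, κ =>
    d.SepVanishes p b w η κ ∧ ∃ κ' : Y ⟶ (d.pull p b w).W, d.Continues p b w η κ κ' ∧
      AllVanish fz η (j + 1) (d.pull p b w).upper
        (fz (j + 1) ((d.pull p b w).q ≫ (d.pull p b w).tow.i)).p
        (fz (j + 1) ((d.pull p b w).q ≫ (d.pull p b w).tow.i)).i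
        (fz (j + 1) ((d.pull p b w).q ≫ (d.pull p b w).tow.i)).fac.symm κ'

/-- Each separated operation is defined as soon as the previous one vanishes: the operation
determined by `κ_{j-1}` is non-empty, it vanishes if and only if there is an admissible
continuation `κ_j`, and each such continuation has the same property for the next operation. -/
def DefinedInTurn (fz : ℕ → Factorizer E) (η : Y ⟶ Q) : ∀ {n : ℕ} (_ : ℕ) (d : Col Q n) {B' : E}
    (p : B' ⟶ d.B) (b : Q ⟶ B') (_ : d.q ≫ d.f = b ≫ p) (_ : Y ⟶ d.W), Prop
  | 0, _, d, _, p, b, w, κ => (d.sepOpLast p b w η κ).Nonempty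
  | _ + 1, j, d, _, p, b, w, κ =>
    (d.sepOp p b w η κ).Nonempty ∧
      (d.SepVanishes p b w η κ ↔ ∃ κ', d.Continues p b w η κ κ') ∧
      ∀ κ' : Y ⟶ (d.pull p b w).W, d.Continues p b w η κ κ' →
        DefinedInTurn fz η (j + 1) (d.pull p b w).upper
          (fz (j + 1) ((d.pull p b w).q ≫ (d.pull p b w).tow.i)).p
          (fz (j + 1) ((d.pull p b w).q ≫ (d.pull p b w).tow.i)).i
          (fz (j + 1) ((d.pull p b w).q ≫ (d.pull p b w).tow.i)).fac.symm κ'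

end Col

end Grid

/-! ### Matching objects, products over levels, and the generalized diagonal -/

section Matching

variable {J : Type w} [SmallCategory J] [WeakLattice J] {P : ObjectProperty J}
variable {E : Type u} [Category.{v} E] [ModelCategory E] (Y : P.FullSubcategory ⥤ E)

/-- The diagram `(f : y ⟶ t) ↦ Y(t)` on the comma category of maps to objects of degree `< m`. -/
def lowDiag (y : J) (m : ℕ) : LowArr P y m ⥤ E where
  obj f := Y.obj f.tgt
  map a := Y.map (LowArr.Hom.map a)
  map_id _ := Y.map_id _
  map_comp _ _ := Y.map_comp _ _

/-- The matching object `𝐌^y_{m-1}(Y)`: the limit over all maps from `y` to objects of degree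
`< m`. -/
def M (y : J) (m : ℕ) : E := limit (lowDiag Y y m)

/-- A cone over `lowDiag Y y m` with vertex `Z`: a compatible family of maps `Z ⟶ Y(t)` indexed by
the maps `y ⟶ t` with `|t| < m`. -/
structure Family (y : J) (m : ℕ) (Z : E) where
  app : ∀ f : LowArr P y m, Z ⟶ Y.obj f.tgt
  comp_map : ∀ (f f' : LowArr P y m) (a : f.tgt ⟶ f'.tgt), f.hom ≫ a.hom = f'.hom →
    app f ≫ Y.map a = app f'

/-- The projections of the matching object. -/
def M.π (y : J) (m : ℕ) (f : LowArr P y m) : M Y y m ⟶ Y.obj f.tgt := limit.π (lowDiag Y y m) f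

/-- The family of all projections of the matching object. -/
def M.family (y : J) (m : ℕ) : Family Y y m (M Y y m) where
  app f := M.π Y y m f
  comp_map f f' a h := limit.w (lowDiag Y y m) (LowArr.Hom.mk (f := f) (g := f') a h)

variable {Y} in
/-- The map to the matching object induced by a compatible family. -/
def M.lift {y : J} {m : ℕ} {Z : E} (c : Family Y y m Z) : Z ⟶ M Y y m :=
  limit.lift (lowDiag Y y m)
    { pt := Z
      π :=
        { app := fun f => c.app f
          naturality := fun f f' a =>
            (Category.id_comp _).trans
              (c.comp_map f f' (LowArr.Hom.map a) (LowArr.Hom.comm a)).symm } }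

variable {Y} in
lemma M.lift_π {y : J} {m : ℕ} {Z : E} (c : Family Y y m Z) (f : LowArr P y m) :
    M.lift c ≫ M.π Y y m f = c.app f :=
  limit.lift_π _ _

variable {Y} in
lemma M.hom_ext {y : J} {m : ℕ} {Z : E} {a b : Z ⟶ M Y y m}
    (h : ∀ f, a ≫ M.π Y y m f = b ≫ M.π Y y m f) : a = b :=
  limit.hom_ext h

/-- The product `∏_{|t| < m} ∏_{𝒥(y,t)} Y(t)`. -/
abbrev Lo (y : J) (m : ℕ) : E := ∏ᶜ fun f : LowArr P y m => Y.obj f.tgt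

/-- The product `∏_{|s| = m} ∏_{𝒥(y,s)} Y(s)`. -/
abbrev Le (y : J) (m : ℕ) : E := ∏ᶜ fun g : LevArr P y m => Y.obj g.tgt

/-- The product `∏_{|s| = m} ∏_{𝒥(y,s)} 𝐌^s_{m-1}`. -/
abbrev LeM (y : J) (m : ℕ) : E := ∏ᶜ fun g : LevArr P y m => M Y g.tgt.obj m

/-- The product `∏_{|s| = m} ∏_{𝒥(y,s)} ∏_{|v| < m} ∏_{𝒥(s,v)} Y(v)`. -/
abbrev LeLo (y : J) (m : ℕ) : E := ∏ᶜ fun g : LevArr P y m => Lo Y g.tgt.obj m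

variable {Y} in
/-- The map `σ_{<m} : Z ⟶ ∏ ∏ Y(t)` given by a compatible family. -/
def sigmaLow {y : J} {m : ℕ} {Z : E} (c : Family Y y m Z) : Z ⟶ Lo Y y m :=
  Limits.Pi.lift c.app

/-- The forgetful map from the matching object to the product. -/
def forget (y : J) (m : ℕ) : M Y y m ⟶ Lo Y y m := sigmaLow (M.family Y y m)

/-- The product over `y ⟶ s`, `|s| = m`, of the forgetful maps. -/
def leForget (y : J) (m : ℕ) : LeM Y y m ⟶ LeLo Y y m :=
  Limits.Pi.map fun g => forget Y g.tgt.obj m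

/-- The generalized diagonal `Ψ`: its component at `y ⟶ s ⟶ v` is the projection to the factor
indexed by the composite. -/
def Psi (y : J) (m : ℕ) : Lo Y y m ⟶ LeLo Y y m :=
  Limits.Pi.lift fun g => Limits.Pi.lift fun f =>
    Limits.Pi.π (fun f' : LowArr P y m => Y.obj f'.tgt) (g.comp f)

/-- The family of the maps `Y(f)`, for all maps `f` out of `s`. -/
def objFamily (s : P.FullSubcategory) (m : ℕ) : Family Y s.obj m (Y.obj s) where
  app f := Y.map (ObjectProperty.homMk f.hom : s ⟶ f.tgt)
  comp_map f f' a h := by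
    rw [← Y.map_comp]
    exact congrArg Y.map (ObjectProperty.hom_ext _ h)

/-- The matching map `Y(s) ⟶ 𝐌^s_{m-1}`. -/
def matchMap (s : P.FullSubcategory) (m : ℕ) : Y.obj s ⟶ M Y s.obj m :=
  M.lift (objFamily Y s m)

/-- The map `Y(s) ⟶ ∏_{|v| < m} ∏_{𝒥(s,v)} Y(v)` with components `Y(f)`. -/
def sigmaObj (s : P.FullSubcategory) (m : ℕ) : Y.obj s ⟶ Lo Y s.obj m :=
  sigmaLow (objFamily Y s m)

/-- Reedy fibrancy: all matching maps `Y(s) ⟶ 𝐌^s_{|s|-1}` are fibrations. -/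
def ReedyFibrant : Prop := ∀ s : P.FullSubcategory, Fibration (matchMap Y s (deg s.obj))

/-- The product over `y ⟶ s`, `|s| = m`, of the matching maps. -/
def leMatch (y : J) (m : ℕ) : Le Y y m ⟶ LeM Y y m :=
  Limits.Pi.map fun g => matchMap Y g.tgt m

/-- The object `𝐐^y_{m-1}`: the pullback of the product of the forgetful maps along `Ψ`. -/
abbrev Q (y : J) (m : ℕ) : E := pullback (Psi Y y m) (leForget Y y m)

variable {Y} in
/-- The restriction of a family along a map `g : y ⟶ s`. -/
def Family.precomp {y : J} {m : ℕ} {Z : E} (c : Family Y y m Z) (g : LevArr P y m) :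
    Family Y g.tgt.obj m Z where
  app f := c.app (g.comp f)
  comp_map f f' a h := c.comp_map (g.comp f) (g.comp f') a
    ((Category.assoc _ _ _).trans (congrArg (g.hom ≫ ·) h))

variable {Y} in
/-- The map `ρ : Z ⟶ ∏_{|s| = m} ∏_{𝒥(y,s)} 𝐌^s_{m-1}` induced by a compatible family. -/
def rho {y : J} {m : ℕ} {Z : E} (c : Family Y y m Z) : Z ⟶ LeM Y y m :=
  Limits.Pi.lift fun g => M.lift (c.precomp g)

variable {Y} in
lemma sigmaLow_Psi {y : J} {m : ℕ} {Z : E} (c : Family Y y m Z) :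
    sigmaLow c ≫ Psi Y y m = rho c ≫ leForget Y y m := by
  refine Limits.Pi.hom_ext _ _ fun g => Limits.Pi.hom_ext _ _ fun f => ?_
  have h₁ : Psi Y y m ≫ Limits.Pi.π _ g ≫ Limits.Pi.π _ f = Limits.Pi.π _ (g.comp f) := by
    rw [Psi, Limits.Pi.lift_π_assoc, Limits.Pi.lift_π]
  have h₂ : leForget Y y m ≫ Limits.Pi.π _ g ≫ Limits.Pi.π _ f =
      Limits.Pi.π _ g ≫ M.π Y g.tgt.obj m f := by
    rw [leForget, Limits.Pi.map_π_assoc, forget, sigmaLow, Limits.Pi.lift_π]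
    rfl
  rw [Category.assoc, Category.assoc, Category.assoc, Category.assoc, h₁, h₂, sigmaLow,
    Limits.Pi.lift_π, rho, Limits.Pi.lift_π_assoc]
  exact (M.lift_π (c.precomp g) f).symm

variable {Y} in
/-- The map `η : Z ⟶ 𝐐^y_{m-1}` induced by a compatible family. -/
def eta {y : J} {m : ℕ} {Z : E} (c : Family Y y m Z) : Z ⟶ Q Y y m :=
  pullback.lift (sigmaLow c) (rho c) (sigmaLow_Psi c)

/-- The object `𝐍^y_{m-1}`. -/
abbrev N (y : J) (m : ℕ) : E :=
  pullback (forget Y y m) (pullback.fst (Psi Y y m) (leForget Y y m))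

/-- The object `𝐏^y_m`. -/
abbrev PObj (y : J) (m : ℕ) : E :=
  pullback (pullback.snd (Psi Y y m) (leForget Y y m)) (leMatch Y y m)

/-- The projections of `𝐌^y_m` belonging to the maps to objects of degree `< m`. -/
def restrFamily (y : J) (m : ℕ) : Family Y y m (M Y y (m + 1)) where
  app f := M.π Y y (m + 1) f.succ
  comp_map f f' a h := (M.family Y y (m + 1)).comp_map f.succ f'.succ a h

/-- The projection of `𝐌^y_m` to the factors of degree `m`. -/
def toLe (y : J) (m : ℕ) : M Y y (m + 1) ⟶ Le Y y m :=
  Limits.Pi.lift fun g => M.π Y y (m + 1) g.toLow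

/-- The projection of `𝐌^y_m` to the factors of degree `< m`. -/
def toLo (y : J) (m : ℕ) : M Y y (m + 1) ⟶ Lo Y y m := sigmaLow (restrFamily Y y m)

/-- The structure map `𝐌^y_m ⟶ 𝐍^y_{m-1}`. -/
def toN (y : J) (m : ℕ) : M Y y (m + 1) ⟶ N Y y m :=
  pullback.lift (M.lift (restrFamily Y y m)) (eta (restrFamily Y y m)) (by
    rw [eta, pullback.lift_fst]
    refine Limits.Pi.hom_ext _ _ fun f => ?_
    simp only [forget, sigmaLow, Category.assoc, Limits.Pi.lift_π]
    exact M.lift_π _ f)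

lemma eta_restr_snd (y : J) (m : ℕ) :
    eta (restrFamily Y y m) ≫ pullback.snd (Psi Y y m) (leForget Y y m) =
      toLe Y y m ≫ leMatch Y y m := by
  rw [eta, pullback.lift_snd]
  refine Limits.Pi.hom_ext _ _ fun g => M.hom_ext fun f => ?_
  have h := (M.family Y y (m + 1)).comp_map g.toLow (g.comp f).succ
    (ObjectProperty.homMk f.hom) rfl
  rw [rho, Limits.Pi.lift_π, M.lift_π, Category.assoc, Category.assoc, leMatch,
    Limits.Pi.map_π_assoc, matchMap, M.lift_π]
  have h' : toLe Y y m ≫ Limits.Pi.π (fun g : LevArr P y m => Y.obj g.tgt) g =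
      M.π Y y (m + 1) g.toLow := by
    rw [toLe, Limits.Pi.lift_π]
  exact (h.symm.trans (by rw [reassoc_of% h']; rfl))

/-- The structure map `𝐌^y_m ⟶ 𝐏^y_m`. -/
def toP (y : J) (m : ℕ) : M Y y (m + 1) ⟶ PObj Y y m :=
  pullback.lift (eta (restrFamily Y y m)) (toLe Y y m) (eta_restr_snd Y y m)

/-- The identification `∏_{|v| = m} Y(v) × ∏_{|t| < m} Y(t) ≅ ∏_{|v| ≤ m} Y(v)`
(products over all maps out of `y`). -/
def joinLo (y : J) (m : ℕ) : Le Y y m ⨯ Lo Y y m ⟶ Lo Y y (m + 1) :=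
  Limits.Pi.lift fun f =>
    if h : deg f.tgt.obj = m then
      prod.fst ≫ Limits.Pi.π (fun g : LevArr P y m => Y.obj g.tgt) ⟨f.tgt, h, f.hom⟩
    else
      prod.snd ≫ Limits.Pi.π (fun f' : LowArr P y m => Y.obj f'.tgt)
        ⟨f.tgt, lt_of_le_of_ne (Nat.lt_succ_iff.mp f.deg_lt) h, f.hom⟩

lemma lift_joinLo (y : J) (m : ℕ) :
    prod.lift (toLe Y y m) (toLo Y y m) ≫ joinLo Y y m = forget Y y (m + 1) := by
  refine Limits.Pi.hom_ext _ _ fun f => ?_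
  by_cases h : deg f.tgt.obj = m
  · simp only [joinLo, forget, sigmaLow, Limits.Pi.lift_π, Category.assoc, h, dite_true,
      prod.lift_fst_assoc, toLe]
    rfl
  · simp only [joinLo, forget, sigmaLow, Limits.Pi.lift_π, Category.assoc, h, dite_false,
      prod.lift_snd_assoc, toLo]
    rfl

/-! ### The separation grid -/

/-- The factorizations chosen in the construction of all separation grids:
* `F y m j` for the map to be factored in the construction of `F_{y,m}^{j,j}`: the generalized
  diagonal for `j = 1`, and the map `𝐐^y_{m-1} ⟶ F_{y,m}^{j-1,j}` for `j ≥ 2`;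
* `G y m` for the map to be factored in the construction of `G_{y,m}^{m-1,m+1}`;
* `F₂ y` for the map `𝐌^y_2 ⟶ ∏_{|v| = 2} ∏_{𝒥(y,v)} Y(v)`, to be factored as a weak equivalence
  followed by a fibration, with intermediate object `F_{y,2}^{1,3}`. -/
structure Choices where
  F : J → ℕ → ℕ → Factorizer E
  G : J → ℕ → Factorizer E
  F₂ : ∀ y : J, MorphismProperty.MapFactorizationData (weakEquivalences E) (fibrations E)
    (toLe Y y 2)

variable {Y} (ch : Choices Y)

/-- The chosen factorization `∏ Y(t) ⟶ F¹ ⟶ ∏ ∏ Y(v)` of the generalized diagonal. -/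
abbrev Choices.F1 (y : J) (m : ℕ) :
    MorphismProperty.MapFactorizationData (trivialCofibrations E) (fibrations E) (Psi Y y m) :=
  ch.F y m 1 (Psi Y y m)

variable (Y) in
/-- The rightmost column `∏ Y(s) ⟶ ∏ 𝐌^s_{m-1} ⟶ ⋯ ⟶ ∏ ∏ Y(v)` of the grid, for a given tower on
the product of the forgetful maps. -/
abbrev col0 (y : J) (m : ℕ) {n : ℕ} (t : Tower n (leForget Y y m)) : Col (Q Y y m) n where
  W := Le Y y m
  A := LeM Y y m
  B := LeLo Y y m
  top := leMatch Y y m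
  f := leForget Y y m
  tow := t
  q := pullback.snd _ _

lemma col0_comm (y : J) (m : ℕ) {n : ℕ} (t : Tower n (leForget Y y m)) :
    (col0 Y y m t).q ≫ (col0 Y y m t).f =
      (pullback.fst (Psi Y y m) (leForget Y y m) ≫ (ch.F1 y m).i) ≫ (ch.F1 y m).p := by
  simp [pullback.condition]

/-- The second column from the right: the pullback of the rightmost one along `F¹ ⟶ ∏ ∏ Y(v)`. -/
abbrev col1 (y : J) (m : ℕ) {n : ℕ} (t : Tower n (leForget Y y m)) : Col (Q Y y m) n :=
  (col0 Y y m t).pull (ch.F1 y m).p (pullback.fst (Psi Y y m) (leForget Y y m) ≫ (ch.F1 y m).i)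
    (col0_comm ch y m t)

/-- The tower `𝐌^y_m ⟶ F_{y,m}^{m-1,m+1} ⟶ ⋯ ⟶ F_{y,m}^{1,m+1} ⟶ ∏_{|v| = m} ∏_{𝒥(y,v)} Y(v)`,
for a given tower on the product of the forgetful maps in degree `m = n + 2`.  For `m ≥ 3` it is the
composite of `𝐌^y_m ⟶ 𝐏^y_m` with the top row of the grid for `y` and `m`. -/
def towerF : ∀ (n : ℕ) (y : J) (_ : Tower n (leForget Y y (n + 2))),
    Tower (n + 1) (toLe Y y (n + 2))
  | 0, y, _ => .step (ch.F₂ y).i (ch.F₂ y).p (ch.F₂ y).fac (.base _)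
  | n + 1, y, t =>
    let m := n + 1 + 2
    let zQ := pullback.fst (pullback.snd (Psi Y y m) (leForget Y y m)) (leMatch Y y m)
    let zW := pullback.snd (pullback.snd (Psi Y y m) (leForget Y y m)) (leMatch Y y m)
    let w : zW ≫ leMatch Y y m = zQ ≫ pullback.snd (Psi Y y m) (leForget Y y m) :=
      pullback.condition.symm
    let z₁ : PObj Y y m ⟶ (col1 ch y m t).W :=
      (col0 Y y m t).liftW _ _ (col0_comm ch y m t) zW zQ w
    let row : Tower (n + 2) zW :=
      .step z₁ ((col0 Y y m t).pullW _ _ (col0_comm ch y m t))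
        ((col0 Y y m t).liftW_pullW _ _ _ zW zQ w)
        ((col1 ch y m t).topRow (fun j => ch.F y m j) 2 z₁ zQ
          ((col0 Y y m t).liftW_top _ _ _ zW zQ w))
    (row.precomp (toP Y y m)).congr (pullback.lift_snd _ _ _)

/-- The tower `𝐌^y_m ⟶ G_{y,m}^{m-1,m+1} ⟶ ⋯ ⟶ G_{y,m}^{1,m+1} ⟶ ∏_{|t| < m} ∏_{𝒥(y,t)} Y(t)`,
for a given tower on the product of the forgetful maps in degree `m = n + 2`: pull back the given
tower along `Ψ`, so that `𝐐^y_{m-1}` is at the top, restrict along `𝐍^y_{m-1} ⟶ 𝐐^y_{m-1}`, factor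
the topmost map as a trivial cofibration followed by a fibration, and restrict along
`𝐌^y_m ⟶ 𝐍^y_{m-1}`. -/
def towerG (n : ℕ) (y : J) (t : Tower n (leForget Y y (n + 2))) :
    Tower (n + 1) (toLo Y y (n + 2)) :=
  let m := n + 2
  let onQ : Tower n (pullback.fst (Psi Y y m) (leForget Y y m)) :=
    t.pb (Psi Y y m) (pullback.snd _ _) (pullback.fst _ _) pullback.condition.symm
  let onN := onQ.precomp
    (pullback.snd (forget Y y m) (pullback.fst (Psi Y y m) (leForget Y y m)))
  ((onN.refineTop (ch.G y m)).precomp (toN Y y m)).congr (by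
    rw [toN, pullback.lift_snd_assoc, eta, pullback.lift_fst, toLo])

/-- The tower `∏ 𝐌^s_{m-1} ⟶ ∏ (F_{s,m-1}^{m-2,m} × G_{s,m-1}^{m-2,m}) ⟶ ⋯ ⟶
∏ (F_{s,m-1}^{1,m} × G_{s,m-1}^{1,m}) ⟶ ∏ ∏_{|v| < m} Y(v)` (products over `y ⟶ s`, `|s| = m`),
of height `m - 2`, where `m = n + 2`. -/
def separation : ∀ (n : ℕ) (y : J), Tower n (leForget Y y (n + 2))
  | 0, _ => .base _
  | n + 1, _ => .pi fun g =>
      (((towerF ch n g.tgt.obj (separation n g.tgt.obj)).prodUnder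
        (towerG ch n g.tgt.obj (separation n g.tgt.obj))).postcomp
          (joinLo Y g.tgt.obj (n + 2))).congr (lift_joinLo Y g.tgt.obj (n + 2))

/-! ### The total operation -/

/-- The object `F²`: the pullback of `F¹` along the product of the forgetful maps. -/
abbrev F2 (y : J) (m : ℕ) : E := pullback (leForget Y y m) (ch.F1 y m).p

/-- The map `γ : 𝐐^y_{m-1} ⟶ F²`. -/
def gammaMap (y : J) (m : ℕ) : Q Y y m ⟶ F2 ch y m :=
  pullback.lift (pullback.snd _ _) (pullback.fst _ _ ≫ (ch.F1 y m).i)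
    (by simp [pullback.condition])

/-- The total higher homotopy operation, for a compatible family `c` on `X = Y(x)` (the strict diagram in
degrees `< m`) and a map `σ` to the objects of degree `m`: all homotopy classes of maps
`θ : X ⟶ F²` for which `φ = q θ` satisfies `φ ∼ ι σ_{<m}` and `Ψ' φ = (∏ σ^s_{<m}) σ`. -/
def totalOp {y : J} {m : ℕ} {X : E} (c : Family Y y m X) (σ : X ⟶ Le Y y m) :
    Set (LeftHomotopyClass X (F2 ch y m)) :=
  {a | ∃ θ : X ⟶ F2 ch y m, a = LeftHomotopyClass.mk θ ∧
    LeftHomotopyRel (θ ≫ pullback.snd _ _) (sigmaLow c ≫ (ch.F1 y m).i) ∧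
    θ ≫ pullback.snd _ _ ≫ (ch.F1 y m).p =
      σ ≫ Limits.Pi.map fun g : LevArr P y m => sigmaObj Y g.tgt m}

/-- The total operation vanishes if it contains the class of `γ η`. -/
def TotalVanishes {y : J} {m : ℕ} {X : E} (c : Family Y y m X) (σ : X ⟶ Le Y y m) : Prop :=
  LeftHomotopyClass.mk (eta c ≫ gammaMap ch y m) ∈ totalOp ch c σ

/-- The `n + 1` separated operations of the separation grid in degree `n + 2` vanish in turn,
starting with `κ₀ = σ`. -/
def SeparatedVanish (n : ℕ) {y : J} {X : E} (c : Family Y y (n + 2) X)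
    (σ : X ⟶ Le Y y (n + 2)) : Prop :=
  (col0 Y y (n + 2) (separation ch n y)).AllVanish (fun j => ch.F y (n + 2) j) (eta c) 1
    _ _ (col0_comm ch y (n + 2) _) σ

/-- The separated operations are defined in turn, starting with `κ₀ = σ`. -/
def SeparatedDefined (n : ℕ) {y : J} {X : E} (c : Family Y y (n + 2) X)
    (σ : X ⟶ Le Y y (n + 2)) : Prop :=
  (col0 Y y (n + 2) (separation ch n y)).DefinedInTurn (fun j => ch.F y (n + 2) j) (eta c) 1
    _ _ (col0_comm ch y (n + 2) _) σ

end Matching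

/-! ### The extension problem -/

section Problem

variable {J : Type w} [SmallCategory J] [WeakLattice J] {E : Type u} [Category.{v} E]
variable {x : J} {m k : ℕ}

/-- The target of a map of degree `< m + 1` as an object of `∂𝒥ₓᵐ`. -/
abbrev lowTgt (f : LowArr (djx x k) x (m + 1)) : (djx x m).FullSubcategory :=
  ⟨f.tgt.obj, ⟨f.tgt.property.1.1, Or.inr (Nat.lt_succ_iff.mp f.deg_lt)⟩, f.tgt.property.2⟩

/-- `x` as an object of `𝒥ₓᵏ`. -/
abbrev apex (x : J) (k : ℕ) : (jx x k).FullSubcategory := ⟨x, jx_self x k⟩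

/-- `Yx : 𝒥ₓᵐ ⥤ E` and `Yk : ∂𝒥ₓᵏ ⥤ E` agree on `∂𝒥ₓᵐ` (where `m ≤ k`). -/
def Agree (Yk : (djx x k).FullSubcategory ⥤ E) (Yx : (jx x m).FullSubcategory ⥤ E)
    (hmk : m ≤ k) : Prop :=
  ObjectProperty.ιOfLE (djx_le_jx x m) ⋙ Yx = ObjectProperty.ιOfLE (djx_mono x hmk) ⋙ Yk

/-- The compatible family of the maps `Yx(f)` for `f : x ⟶ t`, `|t| < m + 1`. -/
def strictFamily (Yk : (djx x k).FullSubcategory ⥤ E) (Yx : (jx x m).FullSubcategory ⥤ E)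
    (hmk : m ≤ k) (h : Agree Yk Yx hmk) : Family Yk x (m + 1) (Yx.obj (apex x m)) where
  app f :=
    Yx.map (ObjectProperty.homMk f.hom :
      apex x m ⟶ (ObjectProperty.ιOfLE (djx_le_jx x m)).obj (lowTgt f)) ≫
    (eqToHom h : ObjectProperty.ιOfLE (djx_le_jx x m) ⋙ Yx ⟶
      ObjectProperty.ιOfLE (djx_mono x hmk) ⋙ Yk).app (lowTgt f)
  comp_map f f' a hw := by
    have hn := (eqToHom h : ObjectProperty.ιOfLE (djx_le_jx x m) ⋙ Yx ⟶
      ObjectProperty.ιOfLE (djx_mono x hmk) ⋙ Yk).naturality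
      (ObjectProperty.homMk a.hom : lowTgt f ⟶ lowTgt f')
    have hc : (ObjectProperty.homMk f'.hom :
          apex x m ⟶ (ObjectProperty.ιOfLE (djx_le_jx x m)).obj (lowTgt f')) =
        (ObjectProperty.homMk f.hom :
          apex x m ⟶ (ObjectProperty.ιOfLE (djx_le_jx x m)).obj (lowTgt f)) ≫
        (ObjectProperty.ιOfLE (djx_le_jx x m)).map
          (ObjectProperty.homMk a.hom : lowTgt f ⟶ lowTgt f') :=
      ObjectProperty.hom_ext _ hw.symm
    rw [hc, Yx.map_comp, Category.assoc, Category.assoc]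
    exact congrArg _ hn.symm

variable {Ho : Type*} [Category Ho] (L : E ⥤ Ho)

/-- A map `σ : Y(x) ⟶ ∏_{|s| = d} ∏_{𝒥(x,s)} Y(s)` represents the homotopy commutative diagram `Yt`
if for each `g : x ⟶ s` with `|s| = d` the component of `σ` at `g` represents `Yt(g)`. -/
def Represents [HasFiniteProducts E] (Yk : (djx x k).FullSubcategory ⥤ E)
    (Yx : (jx x m).FullSubcategory ⥤ E)
    (Yt : (jx x k).FullSubcategory ⥤ Ho) (hmk : m ≤ k)
    (hk : ObjectProperty.ιOfLE (djx_le_jx x k) ⋙ Yt = Yk ⋙ L)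
    (hx : ObjectProperty.ιOfLE (jx_mono x hmk) ⋙ Yt = Yx ⋙ L) {d : ℕ}
    (σ : Yx.obj (apex x m) ⟶ ∏ᶜ fun g : LevArr (djx x k) x d => Yk.obj g.tgt) : Prop :=
  ∀ g : LevArr (djx x k) x d,
    L.map (σ ≫ Limits.Pi.π (fun g : LevArr (djx x k) x d => Yk.obj g.tgt) g) =
      (eqToHom hx.symm).app (apex x m) ≫
        Yt.map (ObjectProperty.homMk g.hom :
          apex x k ⟶ (ObjectProperty.ιOfLE (djx_le_jx x k)).obj g.tgt) ≫
        (eqToHom hk).app g.tgt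

/-- A strict extension: a functor on `𝒥ₓᵏ` which restricts to `Yk` and to `Yx` on the nose and
which lifts `Yt`. -/
def ExtensionExists (Yk : (djx x k).FullSubcategory ⥤ E) (Yx : (jx x m).FullSubcategory ⥤ E)
    (Yt : (jx x k).FullSubcategory ⥤ Ho) (hmk : m ≤ k) : Prop :=
  ∃ Z : (jx x k).FullSubcategory ⥤ E,
    ObjectProperty.ιOfLE (djx_le_jx x k) ⋙ Z = Yk ∧
    ObjectProperty.ιOfLE (jx_mono x hmk) ⋙ Z = Yx ∧
    Z ⋙ L = Yt

end Problem

end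

end HigherOp

/-! Write `X` for Y(x), μ for the product `leMatch` of the matching maps ∏ Y(s) ⟶ ∏ M^s_{k-1}, and ρ
= `rho c` for the map X ⟶ ∏ M^s_{k-1} given by the strict diagram in degrees < k. Each of the three
conditions is equivalent to the single relation μσ ∼ ρ, and the only homotopical tool is the lifting
of homotopies out of a cofibrant object along a fibration (`exists_homotopic_lift`).

Extension (`extensionExists_iff`, `exists_family_iff`): nothing but x maps to x, and distinct
objects of degree k have no maps between them, so a strict extension amounts to a map b : X ⟶ ∏ Y(s)
with μb = ρ that represents the given homotopy diagram. Since X is cofibrant and each Y(s) fibrant,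
the latter means b ∼ σ. As μ is a fibration by Reedy fibrancy, such a b exists exactly when μσ ∼ ρ.

Total operation (`totalVanishes_iff`): the forgetful map ∏ M^s_{k-1} ⟶ ∏∏ Y(v) is a monomorphism, so
the equation imposed on θ forces its component in ∏ M^s_{k-1} to be μσ, while that of γη is ρ.
Projecting gives one implication; lifting the homotopy along F² ⟶ ∏ M^s_{k-1}, a base change of the
fibration Ψ', gives the other.

Separated operations (`Col.allVanish_iff`): the same argument runs one column at a time. The
relation passed along says that κ and η become homotopic in row k. It moves to the next column by
lifting along a base change of q_j, and back by projecting; the monomorphism is needed only at the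
last column.

Non-emptiness needs only the weaker relation in the bottom entry. For the first column it holds
because both maps represent the same homotopy diagram and land in a product of fibrant objects
(`leftHomotopyRel_of_represents`). For each later column it is precisely what a continuation
supplies (`Col.definedInTurn`). -/

namespace HigherOp

/-! ### Lifting homotopies along fibrations, and homotopies into products -/

section Homotopy

variable {E : Type u} [Category.{v} E] [ModelCategory E]

/-- A map can be deformed so as to cover a given deformation of its image under a fibration. -/
lemma exists_homotopic_lift {X A B : E} [IsCofibrant X] (p : A ⟶ B) [Fibration p] (a : X ⟶ A)
    {b : X ⟶ B} (h : LeftHomotopyRel (a ≫ p) b) :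
    ∃ a' : X ⟶ A, LeftHomotopyRel a' a ∧ a' ≫ p = b := by
  -- For cofibrant `X` the end inclusions of a good cylinder are trivial cofibrations, so a homotopy
  -- starting at `a ≫ p` lifts along `p` to one starting at `a`.
  obtain ⟨P, _, ⟨h⟩⟩ := h.exists_good_cylinder
  obtain ⟨a', h', hh⟩ := h.covering_homotopy p a rfl
  refine ⟨a', h'.leftHomotopyRel.symm, ?_⟩
  rw [← h'.h₁, Category.assoc, hh, h.h₁]

/-- Homotopies into a product of fibrant objects can be given componentwise. -/
lemma leftHomotopyRel_pi {X : E} [IsCofibrant X] {I : Type w} [Finite I] {B : I → E}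
    [∀ i, IsFibrant (B i)] {f g : X ⟶ ∏ᶜ B}
    (h : ∀ i, LeftHomotopyRel (f ≫ Limits.Pi.π B i) (g ≫ Limits.Pi.π B i)) :
    LeftHomotopyRel f g := by
  -- Cofibrancy of `X` and fibrancy of the factors allow all componentwise homotopies to be realized
  -- on one common cylinder, where they assemble to a map into the product.
  obtain ⟨P, _⟩ := Cylinder.exists_very_good X
  refine ⟨P, ⟨{ h := Limits.Pi.lift fun i => ((h i).leftHomotopy P).h, h₀ := ?_, h₁ := ?_ }⟩⟩
  · exact Limits.Pi.hom_ext _ _ fun i => by simp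
  · exact Limits.Pi.hom_ext _ _ fun i => by simp

instance isFibrant_pi {I : Type w} [Finite I] (B : I → E) [∀ i, IsFibrant (B i)] :
    IsFibrant (∏ᶜ B) := by
  have : IsFibrant (∏ᶜ fun _ : I => ⊤_ E) := by
    rw [isFibrant_iff_of_isTerminal (𝟙 (∏ᶜ fun _ : I => ⊤_ E))
      (IsTerminal.ofUniqueHom (fun _ => Limits.Pi.lift fun _ => terminal.from _)
        fun _ _ => Limits.Pi.hom_ext _ _ fun _ => Subsingleton.elim _ _)]
    infer_instance
  exact isFibrant_of_fibration (Limits.Pi.map fun i => terminal.from (B i))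

end Homotopy

/-! ### Separated operations of an arbitrary pullback grid -/

namespace Col

variable {E : Type u} [Category.{v} E] [ModelCategory E] {Q Y : E} {n : ℕ}

/-- The map `η ≫ b` lies over the image of `η` in the bottom entry, so it can be deformed along the
fibration `p` until it lies over the image of `κ`. This supplies the `B'`-component of an element of
a separated operation. -/
lemma exists_lift_base (d : Col Q n) {B' : E} (p : B' ⟶ d.B) (b : Q ⟶ B')
    (w : d.q ≫ d.f = b ≫ p) (η : Y ⟶ Q) (κ : Y ⟶ d.W) [IsCofibrant Y] [Fibration p]
    (h : LeftHomotopyRel (κ ≫ d.top ≫ d.f) (η ≫ d.q ≫ d.f)) :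
    ∃ β : Y ⟶ B', LeftHomotopyRel β (η ≫ b) ∧ β ≫ p = κ ≫ d.top ≫ d.f :=
  exists_homotopic_lift p (η ≫ b) (by rw [Category.assoc, ← w]; exact h.symm)

section

variable (d : Col Q n) {B' : E} (p : B' ⟶ d.B) (b : Q ⟶ B') (w : d.q ≫ d.f = b ≫ p)
  (η : Y ⟶ Q) (κ : Y ⟶ d.W)

/-- If the images of `κ` and `η` in the second entry of `d` are homotopic, then `κ` has a lift to
the next column whose image in the second entry is homotopic to that of `η`. -/
lemma exists_lift_pull [IsCofibrant Y] [Fibration p]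
    (h : LeftHomotopyRel (κ ≫ d.top) (η ≫ d.q)) :
    ∃ κ' : Y ⟶ (d.pull p b w).W, κ' ≫ d.pullW p b w = κ ∧
      LeftHomotopyRel (κ' ≫ (d.pull p b w).top) (η ≫ (d.pull p b w).q) := by
  -- The horizontal map in the second entry is a base change of `p`, hence a fibration. The deformed
  -- map `α` lies strictly over `κ ≫ d.top`, so it pairs with `κ` to a map into the pullback `W`.
  obtain ⟨α, hα, hα'⟩ := exists_homotopic_lift (pullback.fst d.f p) (η ≫ (d.pull p b w).q)
    (b := κ ≫ d.top) (by rw [Category.assoc, pullback.lift_fst]; exact h.symm)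
  refine ⟨pullback.lift κ α hα'.symm, pullback.lift_fst _ _ _, ?_⟩
  rwa [pullback.lift_snd]

lemma leftHomotopyRel_of_pull (κ' : Y ⟶ (d.pull p b w).W) (hκ : κ' ≫ d.pullW p b w = κ)
    (h : LeftHomotopyRel (κ' ≫ (d.pull p b w).top) (η ≫ (d.pull p b w).q)) :
    LeftHomotopyRel (κ ≫ d.top) (η ≫ d.q) := by
  have h' := h.postcomp (pullback.fst d.f p)
  have e : pullback.snd d.top (pullback.fst d.f p) ≫ pullback.fst d.f p =
      d.pullW p b w ≫ d.top := pullback.condition.symm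
  rwa [Category.assoc, Category.assoc, pullback.lift_fst, e, reassoc_of% hκ] at h'

end

lemma sepOpLast_nonempty (d : Col Q 0) {B' : E} (p : B' ⟶ d.B) (b : Q ⟶ B')
    (w : d.q ≫ d.f = b ≫ p) (η : Y ⟶ Q) (κ : Y ⟶ d.W) [IsCofibrant Y] [Fibration p]
    (h : LeftHomotopyRel (κ ≫ d.top ≫ d.f) (η ≫ d.q ≫ d.f)) :
    (d.sepOpLast p b w η κ).Nonempty := by
  obtain ⟨β, hβ, hβ'⟩ := d.exists_lift_base p b w η κ h
  refine ⟨_, pullback.lift (κ ≫ d.top) β (by rw [Category.assoc, hβ']), rfl, ?_, ?_⟩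
  · rwa [pullback.lift_snd]
  · rw [pullback.lift_snd_assoc, hβ']

section

variable (d : Col Q (n + 1)) {B' : E} (p : B' ⟶ d.B) (b : Q ⟶ B') (w : d.q ≫ d.f = b ≫ p)
  (η : Y ⟶ Q) (κ : Y ⟶ d.W)

/-- The horizontal map between the lowest intermediate objects of the pulled back column and of
`d`. -/
noncomputable def pullMid : (d.pull p b w).tow.mid ⟶ d.tow.mid :=
  pullback.fst d.tow.p p

lemma pullMid_p : d.pullMid p b w ≫ d.tow.p = (d.pull p b w).tow.p ≫ p :=
  pullback.condition

lemma pull_tow_i_pullMid : (d.pull p b w).tow.i ≫ d.pullMid p b w = pullback.fst d.f p ≫ d.tow.i :=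
  pullback.lift_fst _ _ _

lemma pull_tow_hom_ext {Z : E} {f g : Z ⟶ (d.pull p b w).tow.mid}
    (h : f ≫ d.pullMid p b w = g ≫ d.pullMid p b w)
    (h' : f ≫ (d.pull p b w).tow.p = g ≫ (d.pull p b w).tow.p) : f = g :=
  pullback.hom_ext h h'

lemma pull_tow_i_p : (d.pull p b w).tow.i ≫ (d.pull p b w).tow.p = pullback.snd d.f p :=
  (d.pull p b w).tow.fac

lemma sepOp_nonempty [IsCofibrant Y] [Fibration p]
    (h : LeftHomotopyRel (κ ≫ d.top ≫ d.f) (η ≫ d.q ≫ d.f)) :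
    (d.sepOp p b w η κ).Nonempty := by
  obtain ⟨β, hβ, hβ'⟩ := d.exists_lift_base p b w η κ h
  have e : (κ ≫ d.top ≫ d.tow.i) ≫ d.tow.p = β ≫ p := by
    rw [hβ', Category.assoc, Category.assoc, Tower.fac]
  obtain ⟨θ, h₁, h₂⟩ : ∃ θ : Y ⟶ (d.pull p b w).tow.mid,
      θ ≫ d.pullMid p b w = κ ≫ d.top ≫ d.tow.i ∧ θ ≫ (d.pull p b w).tow.p = β :=
    ⟨pullback.lift _ _ e, pullback.lift_fst _ _ _, pullback.lift_snd _ _ _⟩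
  exact ⟨_, θ, rfl, h₂.symm ▸ hβ, h₁⟩

/-- A separated operation vanishes if and only if there is a continuation. -/
lemma sepVanishes_iff [IsCofibrant Y] :
    d.SepVanishes p b w η κ ↔ ∃ κ', d.Continues p b w η κ κ' := by
  constructor
  · rintro ⟨θ, hc, -, hθ⟩
    rw [LeftHomotopyClass.mk_eq_mk_iff] at hc
    replace hθ : θ ≫ d.pullMid p b w = κ ≫ d.top ≫ d.tow.i := hθ
    have e : (κ ≫ d.top) ≫ d.f = (θ ≫ (d.pull p b w).tow.p) ≫ p := by
      rw [Category.assoc, Category.assoc, ← pullMid_p, reassoc_of% hθ, Tower.fac]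
    -- No homotopy has to be lifted here: all rectangles are pullbacks, so `κ` and the image of `θ`
    -- in `B'` already determine a map to the top of the next column, and its image in the lowest
    -- intermediate object is exactly `θ`.
    refine ⟨pullback.lift (f := d.top) (g := pullback.fst d.f p) κ (pullback.lift _ _ e)
      (pullback.lift_fst _ _ _).symm, pullback.lift_fst _ _ _, ?_⟩
    rw [pullback.lift_snd_assoc]
    convert! hc.symm using 1
    refine d.pull_tow_hom_ext p b w ?_ ?_
    · rw [Category.assoc, pull_tow_i_pullMid, pullback.lift_fst_assoc, hθ, Category.assoc]
    · rw [Category.assoc, pull_tow_i_p, pullback.lift_snd]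
  · rintro ⟨κ', hκ, h⟩
    refine ⟨κ' ≫ (d.pull p b w).top ≫ (d.pull p b w).tow.i,
      (LeftHomotopyClass.mk_eq_mk_iff _ _).2 h.symm, ?_, ?_⟩
    · have h' := h.postcomp (d.pull p b w).tow.p
      simp only [Category.assoc, d.pull_tow_i_p p b w] at h' ⊢
      rwa [pullback.lift_snd] at h'
    · change (κ' ≫ (d.pull p b w).top ≫ (d.pull p b w).tow.i) ≫ d.pullMid p b w = _
      have e : d.pullW p b w ≫ d.top = (d.pull p b w).top ≫ pullback.fst d.f p :=
        pullback.condition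
      rw [Category.assoc, Category.assoc, pull_tow_i_pullMid, ← hκ, Category.assoc,
        reassoc_of% e]

end

instance fibration_factorizer (fz : Factorizer E) {A B : E} (f : A ⟶ B) : Fibration (fz f).p :=
  (fibration_iff _).2 (fz f).hp

/-- Each separated operation is defined once the previous one vanishes, as soon as the initial maps
become homotopic in the lowest entry of the column. -/
lemma definedInTurn (fz : ℕ → Factorizer E) (η : Y ⟶ Q) [IsCofibrant Y] :
    ∀ {n : ℕ} (j : ℕ) (d : Col Q n) {B' : E} (p : B' ⟶ d.B) (b : Q ⟶ B')
      (w : d.q ≫ d.f = b ≫ p) (κ : Y ⟶ d.W) [Fibration p],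
      LeftHomotopyRel (κ ≫ d.top ≫ d.f) (η ≫ d.q ≫ d.f) → DefinedInTurn fz η j d p b w κ
  | 0, _, d, _, p, b, w, κ, _, h => d.sepOpLast_nonempty p b w η κ h
  | _ + 1, j, d, _, p, b, w, κ, _, h =>
    -- The bottom entry of the next column, with its lowest row removed, is the present lowest
    -- intermediate object, so the second clause of `Continues` is the hypothesis of the recursive
    -- call.
    ⟨d.sepOp_nonempty p b w η κ h, d.sepVanishes_iff p b w η κ, fun κ' hκ' =>
      definedInTurn fz η (j + 1) (d.pull p b w).upper _ _ _ κ' hκ'.2⟩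

/-- If the bottom map of the column is a monomorphism, the separated operations vanish in turn if
and only if the initial maps become homotopic in its second entry. -/
lemma allVanish_iff (fz : ℕ → Factorizer E) (η : Y ⟶ Q) [IsCofibrant Y] :
    ∀ {n : ℕ} (j : ℕ) (d : Col Q n) {B' : E} (p : B' ⟶ d.B) (b : Q ⟶ B')
      (w : d.q ≫ d.f = b ≫ p) (κ : Y ⟶ d.W) [Fibration p] [Mono d.f],
      AllVanish fz η j d p b w κ ↔ LeftHomotopyRel (κ ≫ d.top) (η ≫ d.q)
  | 0, _, d, _, p, b, w, κ, _, _ => by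
    constructor
    · rintro ⟨θ, hc, -, hθ⟩
      rw [LeftHomotopyClass.mk_eq_mk_iff] at hc
      have h := hc.symm.postcomp (pullback.fst d.f p)
      -- The last operation prescribes `θ` only after composition with `d.f`; cancelling this
      -- monomorphism recovers its component in `d.A`.
      have e : θ ≫ pullback.fst d.f p = κ ≫ d.top := by
        rw [← cancel_mono d.f, Category.assoc, pullback.condition, hθ, Category.assoc]
      rwa [e, Category.assoc, pullback.lift_fst] at h
    · intro h
      obtain ⟨κ', hκ, h'⟩ := d.exists_lift_pull p b w η κ h
      refine ⟨κ' ≫ (d.pull p b w).top, (LeftHomotopyClass.mk_eq_mk_iff _ _).2 h'.symm, ?_, ?_⟩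
      · have h'' := h'.postcomp (d.pull p b w).f
        rwa [Category.assoc η, pullback.lift_snd] at h''
      · have e : d.pullW p b w ≫ d.top = (d.pull p b w).top ≫ pullback.fst d.f p :=
          pullback.condition
        rw [← pullback.condition, ← hκ, Category.assoc, Category.assoc, reassoc_of% e]
  | _ + 1, j, d, _, p, b, w, κ, _, _ => by
    -- The full vertical map of the new column is a base change of the monomorphism `d.f`, and its
    -- first factor `tow.i` is therefore a monomorphism too.
    have : Mono (d.pull p b w).upper.f := by
      have : Mono ((d.pull p b w).tow.i ≫ (d.pull p b w).tow.p) := by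
        rw [Tower.fac]; infer_instance
      exact mono_of_mono _ (d.pull p b w).tow.p
    constructor
    · rintro ⟨-, κ', hκ, h⟩
      exact d.leftHomotopyRel_of_pull p b w η κ κ' hκ.1
        ((allVanish_iff fz η (j + 1) (d.pull p b w).upper _ _ _ κ').1 h)
    · intro h
      -- An arbitrary continuation would not do: this one is compared with `η` already in the second
      -- entry, which is stronger than `Continues` and is what the next stage requires.
      obtain ⟨κ', hκ, h'⟩ := d.exists_lift_pull p b w η κ h
      have hc : d.Continues p b w η κ κ' := ⟨hκ, by
        simpa only [Category.assoc] using h'.postcomp (d.pull p b w).tow.i⟩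
      exact ⟨(d.sepVanishes_iff p b w η κ).2 ⟨κ', hc⟩, κ', hc,
        (allVanish_iff fz η (j + 1) (d.pull p b w).upper _ _ _ κ').2 h'⟩

end Col

end HigherOp

namespace HigherOp

open WeakLattice

/-! ### Compatible families, matching objects and Reedy fibrancy -/

section Families

variable {J : Type w} [SmallCategory J] [WeakLattice J] {P : ObjectProperty J}
variable {E : Type u} [Category.{v} E] [ModelCategory E] {Y : P.FullSubcategory ⥤ E}
variable {y : J} {m : ℕ} {Z : E}

lemma deg_le_of_hom {a b : J} (f : a ⟶ b) : deg b ≤ deg a := by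
  rcases WeakLattice.deg_lt f with ⟨rfl, -⟩ | h
  · exact le_rfl
  · exact h.le

lemma rho_π (c : Family Y y m Z) (g : LevArr P y m) (f : LowArr P g.tgt.obj m) :
    rho c ≫ Limits.Pi.π (fun g : LevArr P y m => M Y g.tgt.obj m) g ≫ M.π Y g.tgt.obj m f =
      c.app (g.comp f) := by
  rw [rho, Limits.Pi.lift_π_assoc, M.lift_π, Family.precomp]

lemma leMatch_π (g : LevArr P y m) (f : LowArr P g.tgt.obj m) :
    leMatch Y y m ≫ Limits.Pi.π (fun g : LevArr P y m => M Y g.tgt.obj m) g ≫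
        M.π Y g.tgt.obj m f =
      Limits.Pi.π (fun g : LevArr P y m => Y.obj g.tgt) g ≫
        Y.map (ObjectProperty.homMk f.hom : g.tgt ⟶ f.tgt) := by
  rw [leMatch, Limits.Pi.map_π_assoc, matchMap, M.lift_π, objFamily]

lemma leM_hom_ext {a b : Z ⟶ LeM Y y m}
    (h : ∀ (g : LevArr P y m) (f : LowArr P g.tgt.obj m),
      a ≫ Limits.Pi.π (fun g : LevArr P y m => M Y g.tgt.obj m) g ≫ M.π Y g.tgt.obj m f =
        b ≫ Limits.Pi.π (fun g : LevArr P y m => M Y g.tgt.obj m) g ≫ M.π Y g.tgt.obj m f) :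
    a = b :=
  Limits.Pi.hom_ext _ _ fun g => M.hom_ext fun f => by simpa only [Category.assoc] using h g f

/-- A compatible family in degrees `< m` together with compatible values in degree `m`. -/
noncomputable def Family.extend (c : Family Y y m Z) (b : Z ⟶ Le Y y m)
    (hb : b ≫ leMatch Y y m = rho c) : Family Y y (m + 1) Z where
  app f :=
    if h : deg f.tgt.obj = m then
      b ≫ Limits.Pi.π (fun g : LevArr P y m => Y.obj g.tgt) ⟨f.tgt, h, f.hom⟩
    else
      c.app ⟨f.tgt, lt_of_le_of_ne (Nat.lt_succ_iff.mp f.deg_lt) h, f.hom⟩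
  comp_map := by
    rintro ⟨s, hs, f⟩ ⟨t, ht, f'⟩ a hf
    change s ⟶ t at a
    replace hf : f ≫ a.hom = f' := hf
    have hle := deg_le_of_hom a.hom
    have hs' := Nat.lt_succ_iff.mp hs
    -- Maps cannot raise the degree. Inside degree `m` they are identities, from degree `m`
    -- downwards compatibility is the equation `hb`, and below degree `m` it is that of `c`.
    by_cases h : deg s.obj = m
    · by_cases h' : deg t.obj = m
      · rcases WeakLattice.deg_lt a.hom with ⟨e, ha⟩ | hlt
        · obtain rfl : s = t := by cases s; cases t; cases e; rfl
          obtain rfl : a = 𝟙 s := ObjectProperty.hom_ext _ ha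
          obtain rfl : f = f' := (Category.comp_id f).symm.trans hf
          simp [h]
        · exact absurd hlt (by omega)
      · subst hf
        have e := leMatch_π (Y := Y) (⟨s, h, f⟩ : LevArr P y m)
          ⟨t, lt_of_le_of_ne (Nat.lt_succ_iff.mp ht) h', a.hom⟩
        simp only [h, h', dite_true, dite_false, Category.assoc]
        refine (congrArg (b ≫ ·) e.symm).trans ?_
        rw [reassoc_of% hb, rho_π]
    · have h' : deg t.obj ≠ m := by omega
      simp only [h, h', dite_false]
      exact c.comp_map ⟨s, _, f⟩ ⟨t, _, f'⟩ a hf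

lemma Family.extend_app_of_eq (c : Family Y y m Z) (b : Z ⟶ Le Y y m)
    (hb : b ≫ leMatch Y y m = rho c) (g : LevArr P y m) :
    (c.extend b hb).app g.toLow =
      b ≫ Limits.Pi.π (fun g : LevArr P y m => Y.obj g.tgt) g := by
  simp [Family.extend, g.deg_eq]

lemma Family.extend_app_of_lt (c : Family Y y m Z) (b : Z ⟶ Le Y y m)
    (hb : b ≫ leMatch Y y m = rho c) (f : LowArr P y m) :
    (c.extend b hb).app f.succ = c.app f := by
  simp [Family.extend, f.deg_lt.ne]

/-- The part of a compatible family in degrees `< m`. -/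
def Family.restrict (c : Family Y y (m + 1) Z) : Family Y y m Z where
  app f := c.app f.succ
  comp_map f f' a h := c.comp_map f.succ f'.succ a h

/-- The part of a compatible family in degree `m`. -/
noncomputable def Family.level (c : Family Y y (m + 1) Z) : Z ⟶ Le Y y m :=
  Limits.Pi.lift fun g => c.app g.toLow

/-- Compatibility of `c` along the maps from degree `m` to lower degrees; `Family.extend` is the
converse construction. -/
lemma Family.level_leMatch (c : Family Y y (m + 1) Z) :
    c.level ≫ leMatch Y y m = rho c.restrict := by
  refine leM_hom_ext fun g f => ?_
  rw [rho_π, Category.assoc, leMatch_π, Family.level, Limits.Pi.lift_π_assoc]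
  exact c.comp_map g.toLow (g.comp f).succ (ObjectProperty.homMk f.hom) rfl

/-- The compatible family belonging to a map to the matching object. -/
noncomputable def M.familyOf (a : Z ⟶ M Y y m) : Family Y y m Z where
  app f := a ≫ M.π Y y m f
  comp_map f f' α h := by
    rw [Category.assoc]
    exact congrArg (a ≫ ·) ((M.family Y y m).comp_map f f' α h)

lemma rho_familyOf (a : Z ⟶ M Y y m) : rho (M.familyOf a) = a ≫ rho (M.family Y y m) := by
  refine leM_hom_ext fun g f => ?_
  rw [rho_π, Category.assoc, rho_π]
  rfl

variable (Y y m) in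
/-- The matching object in degrees `≤ m` is the pullback of the one in degrees `< m` along the
matching maps in degree `m`. -/
lemma isPullback_matching :
    IsPullback (M.lift (restrFamily Y y m)) (toLe Y y m) (rho (M.family Y y m))
      (leMatch Y y m) := by
  refine ⟨⟨?_⟩, ⟨PullbackCone.IsLimit.mk _
    (fun s => M.lift ((M.familyOf s.fst).extend s.snd
      (by rw [rho_familyOf, s.condition]))) (fun s => ?_) (fun s => ?_) (fun s q h₁ h₂ => ?_)⟩⟩
  · rw [← rho_familyOf]
    refine Eq.trans ?_ ((M.family Y y (m + 1)).level_leMatch).symm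
    congr 1
    simp only [M.familyOf, M.lift_π]
    rfl
  · refine M.hom_ext fun f => ?_
    rw [Category.assoc, M.lift_π]
    exact (M.lift_π _ _).trans (Family.extend_app_of_lt _ _ _ f)
  · refine Limits.Pi.hom_ext _ _ fun g => ?_
    rw [Category.assoc, toLe, Limits.Pi.lift_π]
    exact (M.lift_π _ _).trans (Family.extend_app_of_eq _ _ _ g)
  · refine M.hom_ext fun f => ?_
    rw [M.lift_π]
    by_cases h : deg f.tgt.obj = m
    · refine Eq.trans ?_ (Family.extend_app_of_eq _ _ _ ⟨f.tgt, h, f.hom⟩).symm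
      rw [← h₂, Category.assoc, toLe, Limits.Pi.lift_π]
    · have hlt := lt_of_le_of_ne (Nat.lt_succ_iff.mp f.deg_lt) h
      refine Eq.trans ?_ (Family.extend_app_of_lt _ _ _ ⟨f.tgt, hlt, f.hom⟩).symm
      change _ = s.fst ≫ M.π Y y m ⟨f.tgt, hlt, f.hom⟩
      rw [← h₁, Category.assoc, M.lift_π]
      rfl

variable (y m) in
-- Each factor is the matching map of an object of degree exactly `m`, to which Reedy fibrancy
-- applies; finite products preserve fibrations.
lemma fibration_leMatch (hY : ReedyFibrant Y) : Fibration (leMatch Y y m) := by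
  have (g : LevArr P y m) : Fibration (matchMap Y g.tgt m) := by
    obtain ⟨s, rfl, g⟩ := g
    exact hY s
  exact inferInstanceAs (Fibration (Limits.Pi.map _))

variable (y m) in
-- The matching objects form a tower of fibrations over a terminal object: each step is a base
-- change of `leMatch` by `isPullback_matching`.
lemma isFibrant_matching (hY : ReedyFibrant Y) : IsFibrant (M Y y m) := by
  induction m with
  | zero =>
    rw [isFibrant_iff_of_isTerminal (𝟙 (M Y y 0))
      (IsTerminal.ofUniqueHom
        (fun _ => M.lift ⟨fun f => absurd f.deg_lt (Nat.not_lt_zero _),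
          fun f => absurd f.deg_lt (Nat.not_lt_zero _)⟩)
        fun _ _ => M.hom_ext fun f => absurd f.deg_lt (Nat.not_lt_zero _))]
    infer_instance
  | succ m ih =>
    have := fibration_leMatch y m hY
    have : Fibration (M.lift (restrFamily Y y m)) := by
      rw [fibration_iff] at this ⊢
      exact (fibrations E).of_isPullback (isPullback_matching Y y m).flip this
    exact isFibrant_of_fibration (M.lift (restrFamily Y y m))

/-- A Reedy fibrant diagram is objectwise fibrant. -/
lemma isFibrant_obj (hY : ReedyFibrant Y) (s : P.FullSubcategory) : IsFibrant (Y.obj s) := by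
  have := isFibrant_matching s.obj (deg s.obj) hY
  have := hY s
  exact isFibrant_of_fibration (matchMap Y s (deg s.obj))

lemma forget_π (f : LowArr P y m) :
    forget Y y m ≫ Limits.Pi.π (fun f : LowArr P y m => Y.obj f.tgt) f = M.π Y y m f := by
  rw [forget, sigmaLow, Limits.Pi.lift_π, M.family]

/-- A limit embeds in the product of the values of its diagram. This is what turns equations in ∏∏
Y(v) into equations in ∏ M^s_{m-1}. -/
instance mono_leForget : Mono (leForget Y y m) where
  right_cancellation a b h := leM_hom_ext fun g f => by
    have h' := h =≫ (Limits.Pi.π (fun g : LevArr P y m => Lo Y g.tgt.obj m) g ≫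
      Limits.Pi.π (fun f : LowArr P g.tgt.obj m => Y.obj f.tgt) f)
    simpa only [leForget, Category.assoc, Limits.Pi.map_π_assoc, forget_π] using h'

lemma eta_fst (c : Family Y y m Z) :
    eta c ≫ pullback.fst (Psi Y y m) (leForget Y y m) = sigmaLow c :=
  pullback.lift_fst _ _ _

lemma eta_snd (c : Family Y y m Z) :
    eta c ≫ pullback.snd (Psi Y y m) (leForget Y y m) = rho c :=
  pullback.lift_snd _ _ _

lemma leMatch_leForget :
    leMatch Y y m ≫ leForget Y y m =
      Limits.Pi.map fun g : LevArr P y m => sigmaObj Y g.tgt m := by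
  refine Limits.Pi.hom_ext _ _ fun g => Limits.Pi.hom_ext _ _ fun f => ?_
  simp only [leForget, Category.assoc, Limits.Pi.map_π_assoc, forget_π, leMatch_π]
  rw [sigmaObj, sigmaLow, Limits.Pi.lift_π, objFamily]

end Families

/-! ### Reduction of the operations to one homotopy relation -/

section Operations

variable {J : Type w} [SmallCategory J] [WeakLattice J] {P : ObjectProperty J}
variable {E : Type u} [Category.{v} E] [ModelCategory E] {Y : P.FullSubcategory ⥤ E}

variable (Y) in
lemma nonempty_choices : Nonempty (Choices Y) :=
  ⟨{  F := fun _ _ _ => MorphismProperty.factorizationData _ _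
      G := fun _ _ => MorphismProperty.factorizationData _ _
      F₂ := fun y =>
        let d := MorphismProperty.factorizationData (trivialCofibrations E) (fibrations E)
          (toLe Y y 2)
        { Z := d.Z, i := d.i, p := d.p, fac := d.fac, hi := d.hi.2, hp := d.hp } }⟩

variable {y : J} {m : ℕ} {X : E} [IsCofibrant X]

/-- The total operation is non-empty if the two maps to the target of the generalized diagonal are
homotopic. -/
lemma totalOp_nonempty (ch : Choices Y) (c : Family Y y m X) (σ : X ⟶ Le Y y m)
    (h : LeftHomotopyRel (σ ≫ leMatch Y y m ≫ leForget Y y m) (rho c ≫ leForget Y y m)) :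
    (totalOp ch c σ).Nonempty := by
  obtain ⟨φ, hφ, hφ'⟩ := exists_homotopic_lift (ch.F1 y m).p (sigmaLow c ≫ (ch.F1 y m).i)
    (b := σ ≫ leMatch Y y m ≫ leForget Y y m) (by
      rw [Category.assoc, (ch.F1 y m).fac, sigmaLow_Psi]
      exact h.symm)
  refine ⟨_, pullback.lift (σ ≫ leMatch Y y m) φ (by rw [hφ', Category.assoc]), rfl, ?_, ?_⟩
  · rwa [pullback.lift_snd]
  · rw [pullback.lift_snd_assoc, hφ', leMatch_leForget]

/-- The total operation vanishes if and only if the values in degree `m` are compatible with the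
strict diagram up to homotopy. -/
lemma totalVanishes_iff (ch : Choices Y) (c : Family Y y m X) (σ : X ⟶ Le Y y m) :
    TotalVanishes ch c σ ↔ LeftHomotopyRel (σ ≫ leMatch Y y m) (rho c) := by
  have e : (eta c ≫ gammaMap ch y m) ≫ pullback.fst (leForget Y y m) (ch.F1 y m).p = rho c := by
    rw [Category.assoc, gammaMap, pullback.lift_fst, eta_snd]
  constructor
  · rintro ⟨θ, hc, -, hθ⟩
    rw [LeftHomotopyClass.mk_eq_mk_iff] at hc
    have h := hc.symm.postcomp (pullback.fst (leForget Y y m) (ch.F1 y m).p)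
    -- Since `leForget` is a monomorphism, the strict equation on `θ` determines its component in
    -- `LeM`.
    have e' : θ ≫ pullback.fst (leForget Y y m) (ch.F1 y m).p = σ ≫ leMatch Y y m := by
      rw [← cancel_mono (leForget Y y m), Category.assoc, pullback.condition, hθ, Category.assoc,
        leMatch_leForget]
    rwa [e, e'] at h
  · intro h
    -- The projection F² ⟶ `LeM` is a base change of Ψ', so γη can be deformed to a map lying
    -- strictly over `σ ≫ leMatch Y y m`.
    obtain ⟨θ, hθ, hθ'⟩ := exists_homotopic_lift (pullback.fst (leForget Y y m) (ch.F1 y m).p)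
      (eta c ≫ gammaMap ch y m) (by rw [e]; exact h.symm)
    refine ⟨θ, (LeftHomotopyClass.mk_eq_mk_iff _ _).2 hθ.symm, ?_, ?_⟩
    · have h' := hθ.postcomp (pullback.snd (leForget Y y m) (ch.F1 y m).p)
      rwa [Category.assoc (eta c), gammaMap, pullback.lift_snd, ← Category.assoc (eta c),
        eta_fst] at h'
    · rw [← pullback.condition, reassoc_of% hθ', leMatch_leForget]

lemma separatedDefined {n : ℕ} (ch : Choices Y) (c : Family Y y (n + 2) X)
    (σ : X ⟶ Le Y y (n + 2))
    (h : LeftHomotopyRel (σ ≫ leMatch Y y (n + 2) ≫ leForget Y y (n + 2))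
      (rho c ≫ leForget Y y (n + 2))) : SeparatedDefined ch n c σ := by
  refine Col.definedInTurn _ _ _ _ _ _ _ _ ?_
  rwa [reassoc_of% (eta_snd c)]

lemma separatedVanish_iff {n : ℕ} (ch : Choices Y) (c : Family Y y (n + 2) X)
    (σ : X ⟶ Le Y y (n + 2)) :
    SeparatedVanish ch n c σ ↔ LeftHomotopyRel (σ ≫ leMatch Y y (n + 2)) (rho c) := by
  have : Mono (col0 Y y (n + 2) (separation ch n y)).f := mono_leForget
  refine (Col.allVanish_iff _ _ _ _ _ _ _ _).trans ?_
  rw [eta_snd c]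

/-! ### Comparison with the homotopy category -/

section Localization

variable {Ho : Type*} [Category Ho] (L : E ⥤ Ho) [L.IsLocalization (weakEquivalences E)]
  (φ : ∀ t : P.FullSubcategory, (y ⟶ t.obj) → (L.obj X ⟶ L.obj (Y.obj t)))

/-- Every map in the localization from a cofibrant to a fibrant object comes from the model
category; Reedy fibrancy makes all values of `Y` fibrant. -/
lemma exists_representative (hY : ReedyFibrant Y) :
    ∃ σ : X ⟶ Le Y y m, ∀ g : LevArr P y m,
      L.map (σ ≫ Limits.Pi.π (fun g : LevArr P y m => Y.obj g.tgt) g) = φ g.tgt g.hom := by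
  have h (g : LevArr P y m) : ∃ a : X ⟶ Y.obj g.tgt, L.map a = φ g.tgt g.hom := by
    have := isFibrant_obj hY g.tgt
    exact map_surjective_of_isLocalization L X (Y.obj g.tgt) _
  choose a ha using h
  exact ⟨Limits.Pi.lift a, fun g => by rw [Limits.Pi.lift_π, ha]⟩

variable {L φ}

/-- Two representatives in degree `m` of the same diagram are compatible with the maps to lower
degrees up to homotopy. -/
lemma leftHomotopyRel_of_represents (hY : ReedyFibrant Y)
    (hφ : ∀ {s t : P.FullSubcategory} (f : y ⟶ s.obj) (a : s ⟶ t),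
      φ s f ≫ L.map (Y.map a) = φ t (f ≫ a.hom))
    (c : Family Y y m X) (hc : ∀ f, L.map (c.app f) = φ f.tgt f.hom) (σ : X ⟶ Le Y y m)
    (hσ : ∀ g : LevArr P y m,
      L.map (σ ≫ Limits.Pi.π (fun g : LevArr P y m => Y.obj g.tgt) g) = φ g.tgt g.hom) :
    LeftHomotopyRel (σ ≫ leMatch Y y m ≫ leForget Y y m) (rho c ≫ leForget Y y m) := by
  have hfib := isFibrant_obj hY
  refine leftHomotopyRel_pi fun g => leftHomotopyRel_pi fun f => ?_
  -- At y ⟶ s ⟶ v both maps go from a cofibrant object to the fibrant Y(v), and both represent the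
  -- value of `φ` at the composite.
  rw [LeftHomotopyRel.iff_map_eq L]
  simp only [leForget, Category.assoc, Limits.Pi.map_π_assoc, forget_π, leMatch_π, rho_π]
  rw [hc, ← Category.assoc, L.map_comp, hσ, hφ]
  rfl

/-- A strict diagram in degrees `< m` extends to degree `m`, with prescribed image in the
localization, if and only if it is compatible up to homotopy with a representative in degree `m`. -/
lemma exists_family_iff (hY : ReedyFibrant Y) (c : Family Y y m X)
    (hc : ∀ f, L.map (c.app f) = φ f.tgt f.hom) (σ : X ⟶ Le Y y m)
    (hσ : ∀ g : LevArr P y m,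
      L.map (σ ≫ Limits.Pi.π (fun g : LevArr P y m => Y.obj g.tgt) g) = φ g.tgt g.hom) :
    (∃ c' : Family Y y (m + 1) X, c'.restrict = c ∧
      ∀ f, L.map (c'.app f) = φ f.tgt f.hom) ↔
    LeftHomotopyRel (σ ≫ leMatch Y y m) (rho c) := by
  have hfib := isFibrant_obj hY
  constructor
  · rintro ⟨c', rfl, hc'⟩
    rw [← c'.level_leMatch]
    -- The degree `m` part of `c'` and `σ` represent the same maps to fibrant objects, so they are
    -- homotopic before `leMatch` is applied.
    refine LeftHomotopyRel.postcomp (leftHomotopyRel_pi fun g => ?_) _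
    rw [LeftHomotopyRel.iff_map_eq L, hσ, Family.level, Limits.Pi.lift_π, hc']
  · intro h
    have := fibration_leMatch y m hY
    -- This rectifies `σ`: deforming it along the matching fibration makes it strictly compatible
    -- with `c` without changing its class in the localization.
    obtain ⟨b, hb, hb'⟩ := exists_homotopic_lift (leMatch Y y m) σ h
    refine ⟨c.extend b hb', ?_, fun f => ?_⟩
    · obtain ⟨app, _⟩ := c
      simp only [Family.restrict, Family.extend_app_of_lt]
    · by_cases hd : deg f.tgt.obj = m
      · refine (congrArg L.map (c.extend_app_of_eq b hb' ⟨f.tgt, hd, f.hom⟩)).trans ?_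
        have := hfib f.tgt
        exact ((LeftHomotopyRel.iff_map_eq L _ _).1 (hb.postcomp _)).trans
          (hσ ⟨f.tgt, hd, f.hom⟩)
      · exact (congrArg L.map (c.extend_app_of_lt b hb'
          ⟨f.tgt, lt_of_le_of_ne (Nat.lt_succ_iff.mp f.deg_lt) hd, f.hom⟩)).trans (hc _)

end Localization

end Operations

end HigherOp

namespace HigherOp

open WeakLattice

/-! ### Strict extensions as compatible families at `x` -/

section Extension

variable {J : Type w} [SmallCategory J] [WeakLattice J] {x : J} {k m : ℕ}

/-- The other objects of 𝒥ₓᵏ have degree at most `k`, below that of `x`, so none of them maps to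
`x`. Hence a functor on 𝒥ₓᵏ is given by its restriction to ∂𝒥ₓᵏ, its value at `x` and its maps out
of `x`. -/
lemma eq_apex_of_hom (hk : k < deg x) {a b : (jx x k).FullSubcategory} (f : a ⟶ b)
    (hb : b.obj = x) : a.obj = x :=
  a.property.2.resolve_right fun h => by
    have := deg_le_of_hom f.hom
    rw [hb] at this
    omega

lemma hom_eq_eqToHom {a b : J} (h : a = b) (f : a ⟶ b) : f = eqToHom h := by
  rcases WeakLattice.deg_lt f with ⟨_, hf⟩ | hlt
  · exact hf
  · subst h
    exact absurd hlt (lt_irrefl _)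

/-- Functors on `𝒥ₓᵏ` are equal if they agree on `∂𝒥ₓᵏ`, on `x` and on the maps out of `x`. -/
lemma functor_jx_ext (hk : k < deg x) {C : Type*} [Category C]
    {G G' : (jx x k).FullSubcategory ⥤ C}
    (h₁ : ObjectProperty.ιOfLE (djx_le_jx x k) ⋙ G = ObjectProperty.ιOfLE (djx_le_jx x k) ⋙ G')
    (h₂ : G.obj (apex x k) = G'.obj (apex x k))
    (h₃ : ∀ (t : (djx x k).FullSubcategory) (f : x ⟶ t.obj),
      G.map (ObjectProperty.homMk f : apex x k ⟶ (ObjectProperty.ιOfLE (djx_le_jx x k)).obj t) =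
        eqToHom h₂ ≫
          G'.map (ObjectProperty.homMk f :
            apex x k ⟶ (ObjectProperty.ιOfLE (djx_le_jx x k)).obj t) ≫
          eqToHom (Functor.congr_obj h₁ t).symm) : G = G' := by
  have hx : ∀ a : (jx x k).FullSubcategory, a.obj = x → a = apex x k := by
    rintro ⟨a, ha⟩ h
    obtain rfl : a = x := h
    rfl
  have hobj : ∀ a, G.obj a = G'.obj a := fun a => by
    by_cases ha : a.obj = x
    · rw [hx a ha, h₂]
    · exact Functor.congr_obj h₁ ⟨a.obj, a.property, ha⟩
  refine CategoryTheory.Functor.ext hobj fun a b f => ?_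
  by_cases hb : b.obj = x
  · obtain rfl := hx a (eq_apex_of_hom hk f hb)
    obtain rfl := hx b hb
    obtain rfl : f = 𝟙 _ := ObjectProperty.hom_ext _ (hom_eq_eqToHom rfl _)
    simp
  · by_cases ha : a.obj = x
    · obtain rfl := hx a ha
      exact h₃ ⟨b.obj, b.property, hb⟩ f.hom
    · exact Functor.congr_hom h₁ (X := ⟨a.obj, a.property, ha⟩) (Y := ⟨b.obj, b.property, hb⟩)
        (ObjectProperty.homMk f.hom)

variable {E : Type u} [Category.{v} E]

/-! ### Gluing a compatible family at `x` to a diagram on ∂𝒥ₓᵏ -/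

section Glue

variable (F : (djx x k).FullSubcategory ⥤ E) {X : E}

open Classical in
/-- The values on objects of the extension of `F` by `X` at `x`. -/
noncomputable def glueObj (X : E) (t : (jx x k).FullSubcategory) : E :=
  if h : t.obj = x then X else F.obj ⟨t.obj, t.property, h⟩

lemma glueObj_of_eq {t : (jx x k).FullSubcategory} (h : t.obj = x) : glueObj F X t = X :=
  dif_pos h

lemma glueObj_of_ne {t : (jx x k).FullSubcategory} (h : t.obj ≠ x) :
    glueObj F X t = F.obj ⟨t.obj, t.property, h⟩ :=
  dif_neg h

/-- A map out of `x` to an object of `∂𝒥ₓᵏ`. -/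
abbrev arrOf (t : (djx x k).FullSubcategory) (f : x ⟶ t.obj) : LowArr (djx x k) x (k + 1) where
  tgt := t
  deg_lt := Nat.lt_succ_of_le (t.property.1.2.resolve_left t.property.2)
  hom := f

variable {F}

open Classical in
/-- The values on maps of the extension of `F` by a compatible family at `x`. -/
noncomputable def glueMap (hk : k < deg x) (c : Family F x (k + 1) X)
    {a b : (jx x k).FullSubcategory} (f : a ⟶ b) : glueObj F X a ⟶ glueObj F X b :=
  if hb : b.obj = x then
    eqToHom ((glueObj_of_eq F (eq_apex_of_hom hk f hb)).trans (glueObj_of_eq F hb).symm)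
  else if ha : a.obj = x then
    eqToHom (glueObj_of_eq F ha) ≫
      c.app (arrOf ⟨b.obj, b.property, hb⟩ (eqToHom ha.symm ≫ f.hom)) ≫
      eqToHom (glueObj_of_ne F hb).symm
  else
    eqToHom (glueObj_of_ne F ha) ≫
      F.map (ObjectProperty.homMk f.hom :
        (⟨a.obj, a.property, ha⟩ : (djx x k).FullSubcategory) ⟶ ⟨b.obj, b.property, hb⟩) ≫
      eqToHom (glueObj_of_ne F hb).symm

/-- The extension of `F` to `𝒥ₓᵏ` by a compatible family of maps from `X`. -/
noncomputable def glue (hk : k < deg x) (c : Family F x (k + 1) X) :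
    (jx x k).FullSubcategory ⥤ E where
  obj := glueObj F X
  map := glueMap hk c
  map_id a := by
    by_cases ha : a.obj = x
    · simp [glueMap, ha]
    · have : (ObjectProperty.homMk (𝟙 a.obj) :
          (⟨a.obj, a.property, ha⟩ : (djx x k).FullSubcategory) ⟶ ⟨a.obj, a.property, ha⟩) =
          𝟙 _ := rfl
      simp [glueMap, ha, this]
  map_comp {a b d} f g := by
    by_cases hd : d.obj = x
    · have hb := eq_apex_of_hom hk g hd
      simp [glueMap, hd, hb]
    -- If the middle object is `x`, then so is the source and `f` is an identity. If only the source
    -- is `x`, functoriality is compatibility of the family `c`; otherwise it is functoriality of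
    -- `F`.
    · by_cases hb : b.obj = x
      · have ha := eq_apex_of_hom hk f hb
        have hf : eqToHom ha.symm ≫ f.hom ≫ g.hom = eqToHom hb.symm ≫ g.hom := by
          rw [hom_eq_eqToHom (ha.trans hb.symm) f.hom, eqToHom_trans_assoc]
        simp only [glueMap, hd, hb, ha, dite_true, dite_false, eqToHom_trans_assoc]
        exact congrArg (fun q => eqToHom _ ≫ c.app (arrOf _ q) ≫ eqToHom _) hf
      · by_cases ha : a.obj = x
        · have h := c.comp_map (arrOf ⟨b.obj, b.property, hb⟩ (eqToHom ha.symm ≫ f.hom))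
            (arrOf ⟨d.obj, d.property, hd⟩ (eqToHom ha.symm ≫ f.hom ≫ g.hom))
            (ObjectProperty.homMk g.hom) (by simp)
          simp [glueMap, hd, hb, ha, ← h]
        · have : (ObjectProperty.homMk (f.hom ≫ g.hom) :
              (⟨a.obj, a.property, ha⟩ : (djx x k).FullSubcategory) ⟶ ⟨d.obj, d.property, hd⟩) =
              (ObjectProperty.homMk f.hom : _ ⟶
                (⟨b.obj, b.property, hb⟩ : (djx x k).FullSubcategory)) ≫
              ObjectProperty.homMk g.hom := rfl
          simp [glueMap, hd, hb, ha, this]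

variable (hk : k < deg x) (c : Family F x (k + 1) X)

lemma glue_obj_apex : (glue hk c).obj (apex x k) = X :=
  glueObj_of_eq F rfl

lemma glue_restrict : ObjectProperty.ιOfLE (djx_le_jx x k) ⋙ glue hk c = F := by
  refine CategoryTheory.Functor.ext (fun t => glueObj_of_ne F t.property.2) fun s t f => ?_
  have hs : ((ObjectProperty.ιOfLE (djx_le_jx x k)).obj s).obj ≠ x := s.property.2
  have ht : ((ObjectProperty.ιOfLE (djx_le_jx x k)).obj t).obj ≠ x := t.property.2
  simp only [Functor.comp_map, glue, glueMap, hs, ht, dite_false]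
  rfl

lemma glue_map_apex (t : (djx x k).FullSubcategory) (f : x ⟶ t.obj) :
    (glue hk c).map
        (ObjectProperty.homMk f : apex x k ⟶ (ObjectProperty.ιOfLE (djx_le_jx x k)).obj t) =
      eqToHom (glue_obj_apex hk c) ≫ c.app (arrOf t f) ≫
        eqToHom (Functor.congr_obj (glue_restrict hk c) t).symm := by
  have ht : ((ObjectProperty.ιOfLE (djx_le_jx x k)).obj t).obj ≠ x := t.property.2
  have e : eqToHom (rfl : x = x).symm ≫ f = f := Category.id_comp f
  simp only [glue, glueMap, ht, dite_false, dite_true]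
  exact congrArg (fun q => eqToHom _ ≫ c.app (arrOf t q) ≫ eqToHom _) e

end Glue

variable {Ho : Type*} [Category Ho] (L : E ⥤ Ho)

/-! ### The homotopy diagram as data on maps out of `x` -/

section Problem

variable (Yk : (djx x k).FullSubcategory ⥤ E) (Yx : (jx x m).FullSubcategory ⥤ E)
    (Yt : (jx x k).FullSubcategory ⥤ Ho) (hmk : m ≤ k)
    (hYk : ObjectProperty.ιOfLE (djx_le_jx x k) ⋙ Yt = Yk ⋙ L)
    (hYx : ObjectProperty.ιOfLE (jx_mono x hmk) ⋙ Yt = Yx ⋙ L)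

/-- The maps out of `x` of the diagram `Yt`, as maps between the images of the values of `Yx` and
`Yk`. -/
def homotopyMap (t : (djx x k).FullSubcategory) (f : x ⟶ t.obj) :
    L.obj (Yx.obj (apex x m)) ⟶ L.obj (Yk.obj t) :=
  (eqToHom hYx.symm).app (apex x m) ≫
    Yt.map (ObjectProperty.homMk f :
      apex x k ⟶ (ObjectProperty.ιOfLE (djx_le_jx x k)).obj t) ≫
    (eqToHom hYk).app t

lemma homotopyMap_comp {s t : (djx x k).FullSubcategory} (f : x ⟶ s.obj) (a : s ⟶ t) :
    homotopyMap L Yk Yx Yt hmk hYk hYx s f ≫ L.map (Yk.map a) =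
      homotopyMap L Yk Yx Yt hmk hYk hYx t (f ≫ a.hom) := by
  have h := (eqToHom hYk).naturality a
  simp only [homotopyMap, Category.assoc]
  rw [← Functor.comp_map, ← h]
  congr 1
  rw [← Category.assoc, Functor.comp_map, ← Yt.map_comp]
  rfl

variable (hagree : Agree Yk Yx hmk)

/-- Since `Yx` lifts `Yt`, the strict family represents it in low degrees. The content of the proof
is that the transports along `hYx`, `hYk` and `hagree` fit together. -/
lemma map_strictFamily (f : LowArr (djx x k) x (m + 1)) :
    L.map ((strictFamily Yk Yx hmk hagree).app f) =
      homotopyMap L Yk Yx Yt hmk hYk hYx f.tgt f.hom := by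
  have h := Functor.congr_hom hYx (ObjectProperty.homMk f.hom :
      apex x m ⟶ (ObjectProperty.ιOfLE (djx_le_jx x m)).obj (lowTgt f))
  have h' : Yt.map (ObjectProperty.homMk f.hom :
      apex x k ⟶ (ObjectProperty.ιOfLE (djx_le_jx x k)).obj f.tgt) = _ := h
  have e := eqToHom_app hagree (lowTgt f)
  rw [strictFamily, homotopyMap, h', L.map_comp, e, eqToHom_app, eqToHom_app, eqToHom_map]
  simp

end Problem

/-! ### The extension problem in terms of families -/

section Extend

variable {Yk : (djx x (m + 1)).FullSubcategory ⥤ E}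
  {Yx : (jx x m).FullSubcategory ⥤ E} {Yt : (jx x (m + 1)).FullSubcategory ⥤ Ho}
  (hagree : Agree Yk Yx (Nat.le_succ m))
  (hYk : ObjectProperty.ιOfLE (djx_le_jx x (m + 1)) ⋙ Yt = Yk ⋙ L)
  (hYx : ObjectProperty.ιOfLE (jx_mono x (Nat.le_succ m)) ⋙ Yt = Yx ⋙ L)

/-- Strict extensions correspond to extensions of the compatible family at `x`. -/
lemma extensionExists_iff (hk : m + 1 < deg x) :
    ExtensionExists L Yk Yx Yt (Nat.le_succ m) ↔
      ∃ c' : Family Yk x (m + 2) (Yx.obj (apex x m)),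
        c'.restrict = strictFamily Yk Yx (Nat.le_succ m) hagree ∧
        ∀ f, L.map (c'.app f) =
          homotopyMap L Yk Yx Yt (Nat.le_succ m) hYk hYx f.tgt f.hom := by
  constructor
  -- Substituting `Z` for the three given diagrams makes every transport an identity.
  · rintro ⟨Z, rfl, rfl, rfl⟩
    refine ⟨⟨fun f => Z.map (ObjectProperty.homMk f.hom :
      apex x (m + 1) ⟶ (ObjectProperty.ιOfLE (djx_le_jx x (m + 1))).obj f.tgt), ?_⟩, ?_, ?_⟩
    · rintro f f' a h
      refine (Z.map_comp _ _).symm.trans (congrArg Z.map (ObjectProperty.hom_ext _ h))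
    · simp only [Family.restrict, strictFamily]
      congr 1
      funext f
      exact (Category.comp_id _).symm
    · intro f
      simp only [homotopyMap, eqToHom_refl, NatTrans.id_app]
      exact ((Category.id_comp _).trans (Category.comp_id _)).symm
  · rintro ⟨c', hc', hL⟩
    refine ⟨glue hk c', glue_restrict hk c', ?_, ?_⟩
    -- Both remaining equalities of functors reduce to maps out of `x`: on 𝒥ₓᵐ these are the
    -- prescribed restriction of `c'`, and after `L` they are the prescribed values of
    -- `homotopyMap`.
    · refine functor_jx_ext ((Nat.lt_succ_self m).trans hk)
        ((congrArg (ObjectProperty.ιOfLE (djx_mono x (Nat.le_succ m)) ⋙ ·)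
          (glue_restrict hk c')).trans hagree.symm) (glue_obj_apex hk c') fun t f => ?_
      have h := glue_map_apex hk c' ((ObjectProperty.ιOfLE (djx_mono x (Nat.le_succ m))).obj t) f
      have hf : deg t.obj < m + 1 :=
        Nat.lt_succ_of_le (t.property.1.2.resolve_left t.property.2)
      have h' : c'.app (arrOf ((ObjectProperty.ιOfLE (djx_mono x (Nat.le_succ m))).obj t) f) =
          Yx.map (ObjectProperty.homMk f :
              apex x m ⟶ (ObjectProperty.ιOfLE (djx_le_jx x m)).obj t) ≫
            eqToHom (Functor.congr_obj hagree t) :=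
        (congrFun (congrArg Family.app hc')
          ⟨(ObjectProperty.ιOfLE (djx_mono x (Nat.le_succ m))).obj t, hf, f⟩).trans
          (congrArg (Yx.map _ ≫ ·) (eqToHom_app hagree t))
      refine h.trans ?_
      rw [h', Category.assoc, eqToHom_trans]
    · refine functor_jx_ext hk
        ((congrArg (· ⋙ L) (glue_restrict hk c')).trans hYk.symm)
        ((congrArg L.obj (glue_obj_apex hk c')).trans
          (Functor.congr_obj hYx (apex x m)).symm) fun t f => ?_
      rw [Functor.comp_map, glue_map_apex, L.map_comp, L.map_comp, hL]
      simp only [homotopyMap, eqToHom_app, eqToHom_map, Category.assoc, eqToHom_trans,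
        eqToHom_trans_assoc]

end Extend

end Extension

end HigherOp

theorem mainTheorem1
    {J : Type w} [SmallCategory J] [WeakLattice J]
    {E : Type u} [Category.{v} E] [ModelCategory E]
    {Ho : Type*} [Category Ho] (L : E ⥤ Ho) [L.IsLocalization (weakEquivalences E)]
    (x : J) (n l : ℕ) (hx : n < WeakLattice.deg x) (hn : l + 2 ≤ n)
    (Yt : (HigherOp.jx x (l + 2)).FullSubcategory ⥤ Ho)
    (Yx : (HigherOp.jx x (l + 1)).FullSubcategory ⥤ E)
    (Yk : (HigherOp.djx x (l + 2)).FullSubcategory ⥤ E)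
    (hagree : HigherOp.Agree Yk Yx (Nat.le_succ (l + 1)))
    (hYk : ObjectProperty.ιOfLE (HigherOp.djx_le_jx x (l + 2)) ⋙ Yt = Yk ⋙ L)
    (hYx : ObjectProperty.ιOfLE (HigherOp.jx_mono x (Nat.le_succ (l + 1))) ⋙ Yt = Yx ⋙ L)
    (hfib : HigherOp.ReedyFibrant Yk)
    (hcof : IsCofibrant (Yx.obj (HigherOp.apex x (l + 1)))) :
    Nonempty (HigherOp.Choices Yk) ∧
    (∃ σ, HigherOp.Represents L Yk Yx Yt (Nat.le_succ (l + 1)) hYk hYx (d := l + 2) σ) ∧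
    ∀ (ch : HigherOp.Choices Yk)
      (σ : Yx.obj (HigherOp.apex x (l + 1)) ⟶ HigherOp.Le Yk x (l + 2)),
      HigherOp.Represents L Yk Yx Yt (Nat.le_succ (l + 1)) hYk hYx σ →
      (HigherOp.totalOp ch (HigherOp.strictFamily Yk Yx (Nat.le_succ (l + 1)) hagree) σ).Nonempty ∧
      HigherOp.SeparatedDefined ch l
        (HigherOp.strictFamily Yk Yx (Nat.le_succ (l + 1)) hagree) σ ∧
      [ HigherOp.ExtensionExists L Yk Yx Yt (Nat.le_succ (l + 1)),
        HigherOp.TotalVanishes ch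
          (HigherOp.strictFamily Yk Yx (Nat.le_succ (l + 1)) hagree) σ,
        HigherOp.SeparatedVanish ch l
          (HigherOp.strictFamily Yk Yx (Nat.le_succ (l + 1)) hagree) σ ].TFAE := by
  -- Here k = l + 2, so k ≥ 2 is built in and `l` is the number of intermediate objects in column 0
  -- between ∏ M^s_{k-1} and the bottom entry.
  have hk : l + 1 + 1 < WeakLattice.deg x := lt_of_le_of_lt hn hx
  have hc := HigherOp.map_strictFamily L Yk Yx Yt (Nat.le_succ (l + 1)) hYk hYx hagree
  refine ⟨HigherOp.nonempty_choices Yk,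
    HigherOp.exists_representative L
      (HigherOp.homotopyMap L Yk Yx Yt (Nat.le_succ (l + 1)) hYk hYx) hfib,
    fun ch σ hσ => ?_⟩
  have h := HigherOp.leftHomotopyRel_of_represents hfib
    (HigherOp.homotopyMap_comp L Yk Yx Yt (Nat.le_succ (l + 1)) hYk hYx) _ hc σ hσ
  refine ⟨HigherOp.totalOp_nonempty ch _ σ h, HigherOp.separatedDefined ch _ σ h, ?_⟩
  tfae_have 1 ↔ 2 := by
    rw [HigherOp.extensionExists_iff L hagree hYk hYx hk, HigherOp.totalVanishes_iff]
    exact HigherOp.exists_family_iff hfib _ hc σ hσ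
  tfae_have 2 ↔ 3 := by
    rw [HigherOp.totalVanishes_iff, HigherOp.separatedVanish_iff]
  tfae_finish
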